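/- Let $(M,\langle\cdot,\cdot\rangle)$ be a closed (compact, connected, without boundary) smooth Riemannian manifold of dimension $n$ whose Ricci curvature satisfies $\mathrm{Ric}\ge (n-1)\kappa$ for some constant $\kappa\in\mathbb{R}$, that is, $\mathrm{Ric}(v,v)\ge (n-1)\kappa\langle v,v\rangle$ for every tangent vector $v$. Let $g:\mathbb{R}\to\mathbb{R}$ be a continuous function, and suppose that there is a discrete subset $S$ of $[0,+\infty)$ such that $$g(t)\left(\frac{2(n-1)\,t\,g(t)}{n}-3\int_0^t g(\sigma)\,d\sigma-(n-1)\kappa t^2\right)\ \begin{cases}=0,& t\in S,\\ <0,& t\in[0,+\infty)\setminus S.\end{cases}$$ Then every non-negative solution $u\in C^2(M)$ of the equation $\Delta u=-g(u)$ on $M$ is constant, where $\Delta$ is the Laplace–Beltrami operator (the trace of the Hessian). -/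

import Mathlib

open scoped Manifold ContDiff Bundle

noncomputable section

/-- Smooth Riemannian metrics on a manifold `M` modelled on `ℝⁿ`. -/
abbrev SmoothMetric (n : ℕ) (M : Type*) [TopologicalSpace M]
    [ChartedSpace (EuclideanSpace ℝ (Fin n)) M] [IsManifold (𝓡 n) ∞ M] :=
  Bundle.ContMDiffRiemannianMetric (𝓡 n) ∞ (EuclideanSpace ℝ (Fin n))
    (fun x : M ↦ TangentSpace (𝓡 n) x)

namespace LocalGeometry

/-! ### Riemannian geometry in coordinates

Here `G : ℝⁿ → Matrix` is the matrix field `(G_ij)` of a Riemannian metric on an open subset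
of `ℝⁿ`. -/

variable {n : ℕ}

/-- The partial derivative `∂_i f`. -/
def partialDeriv (i : Fin n) (f : EuclideanSpace ℝ (Fin n) → ℝ)
    (y : EuclideanSpace ℝ (Fin n)) : ℝ :=
  fderiv ℝ f y (EuclideanSpace.single i 1)

/-- The Christoffel symbol
`Γ^k_ij = 1/2 ∑_l G^kl (∂_i G_jl + ∂_j G_il - ∂_l G_ij)` of the Levi-Civita connection. -/
def christoffel (G : EuclideanSpace ℝ (Fin n) → Matrix (Fin n) (Fin n) ℝ) (k i j : Fin n)
    (y : EuclideanSpace ℝ (Fin n)) : ℝ :=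
  (1 / 2) * ∑ l, (G y)⁻¹ k l *
    (partialDeriv i (fun z ↦ G z j l) y + partialDeriv j (fun z ↦ G z i l) y
      - partialDeriv l (fun z ↦ G z i j) y)

/-- The components of the Ricci tensor,
`R_ij = ∑_k (∂_k Γ^k_ij - ∂_j Γ^k_ki) + ∑_k ∑_l (Γ^k_kl Γ^l_ij - Γ^k_jl Γ^l_ki)`,
with the sign for which round spheres have positive Ricci curvature. -/
def ricci (G : EuclideanSpace ℝ (Fin n) → Matrix (Fin n) (Fin n) ℝ) (i j : Fin n)
    (y : EuclideanSpace ℝ (Fin n)) : ℝ :=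
  ∑ k, (partialDeriv k (christoffel G k i j) y - partialDeriv j (christoffel G k k i) y)
    + ∑ k, ∑ l, (christoffel G k k l y * christoffel G l i j y
        - christoffel G k j l y * christoffel G l k i y)

/-- The Hessian components `∇²_ij f = ∂_i ∂_j f - ∑_k Γ^k_ij ∂_k f`. -/
def hessian (G : EuclideanSpace ℝ (Fin n) → Matrix (Fin n) (Fin n) ℝ)
    (f : EuclideanSpace ℝ (Fin n) → ℝ) (i j : Fin n) (y : EuclideanSpace ℝ (Fin n)) : ℝ :=
  partialDeriv i (partialDeriv j f) y - ∑ k, christoffel G k i j y * partialDeriv k f y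

/-- The Laplacian `∑_ij G^ij ∇²_ij f`, the trace of the Hessian. -/
def laplacian (G : EuclideanSpace ℝ (Fin n) → Matrix (Fin n) (Fin n) ℝ)
    (f : EuclideanSpace ℝ (Fin n) → ℝ) (y : EuclideanSpace ℝ (Fin n)) : ℝ :=
  ∑ i, ∑ j, (G y)⁻¹ i j * hessian G f i j y

end LocalGeometry

namespace SmoothMetric

variable {n : ℕ} {M : Type*} [TopologicalSpace M]
  [ChartedSpace (EuclideanSpace ℝ (Fin n)) M] [IsManifold (𝓡 n) ∞ M]

/-- The coordinate vector field `∂/∂x_i` of the chart `extChartAt p`, at the point of `M` with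
coordinates `y`. -/
def coordVec (p : M) (y : EuclideanSpace ℝ (Fin n)) (i : Fin n) :
    TangentSpace (𝓡 n) ((extChartAt (𝓡 n) p).symm y) :=
  mfderiv 𝓘(ℝ, EuclideanSpace ℝ (Fin n)) (𝓡 n) (extChartAt (𝓡 n) p).symm y
    (EuclideanSpace.single i (1 : ℝ) : EuclideanSpace ℝ (Fin n))

/-- The components `G_ij` of the metric in the chart around `p`, as functions of the
coordinates. -/
def inChart (m : SmoothMetric n M) (p : M) (y : EuclideanSpace ℝ (Fin n)) :
    Matrix (Fin n) (Fin n) ℝ :=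
  Matrix.of fun i j ↦
    m.inner ((extChartAt (𝓡 n) p).symm y) (coordVec p y i) (coordVec p y j)

/-- The components of a tangent vector at `p` in the coordinate basis of the chart around `p`. -/
def vecCoord (p : M) (v : TangentSpace (𝓡 n) p) : EuclideanSpace ℝ (Fin n) :=
  mfderiv (𝓡 n) 𝓘(ℝ, EuclideanSpace ℝ (Fin n)) (extChartAt (𝓡 n) p) p v

/-- The Ricci tensor at `p`, computed in the chart around `p`. -/
def ricci (m : SmoothMetric n M) (p : M) (v w : TangentSpace (𝓡 n) p) : ℝ :=
  ∑ i, ∑ j, LocalGeometry.ricci (m.inChart p) i j (extChartAt (𝓡 n) p p)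
    * vecCoord p v i * vecCoord p w j

/-- `Ric ≥ K`: the Ricci curvature is bounded below by `K`. -/
def RicciBoundedBelow (m : SmoothMetric n M) (K : ℝ) : Prop :=
  ∀ (p : M) (v : TangentSpace (𝓡 n) p), K * m.inner p v v ≤ m.ricci p v v

/-- The Laplace-Beltrami operator `Δ u = div ∇u = tr ∇²u` at `p`, computed in the chart
around `p`. -/
def laplacian (m : SmoothMetric n M) (u : M → ℝ) (p : M) : ℝ :=
  LocalGeometry.laplacian (m.inChart p) (u ∘ (extChartAt (𝓡 n) p).symm) (extChartAt (𝓡 n) p p)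

end SmoothMetric

end

/-! The Bochner formula and the Cauchy–Schwarz inequality `|∇²f|² ≥ (Δf)² / n` turn `Ric ≥ K` into
the pointwise inequality `Δ|∇f|² / 2 - ⟨∇f, ∇Δf⟩ ≥ (Δf)² / n + K |∇f|²`. Multiplied by a weight
`w ≥ 0` and integrated by parts, it becomes an inequality which only involves derivatives of `f` of
order at most two, and which therefore passes, by mollification in charts, to `C²` functions.

For a solution `u ≥ 0` of `Δu = -g(u)` take `f = w = u` and `K = (n - 1)κ`. The terms containing
`|∇u|²` are eliminated by adding multiples of `∫ ΔH(u) = 0`, where `H'' = g`, and of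
`∫ Δ(u³) = 0`. What remains is `0 ≤ ∫ Φ(u)`, where `Φ(t)` is the function whose sign is prescribed
by the hypotheses. Since `Φ ≤ 0` on `[0, ∞)`, the function `Φ(u)` vanishes identically, so that `u`
takes its values in the totally disconnected zero set of `Φ`, and is constant as `M` is
connected. -/

noncomputable section

/-- The coordinate space `ℝⁿ`. -/
abbrev Euc (n : ℕ) := EuclideanSpace ℝ (Fin n)

namespace LocalGeometry

open Filter Topology Matrix MeasureTheory

variable {n : ℕ}

/-! ### Partial derivatives -/

section PartialDeriv

variable {f h : Euc n → ℝ} {y : Euc n}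

lemma partialDeriv_congr (i : Fin n) (e : f =ᶠ[𝓝 y] h) :
    partialDeriv i f y = partialDeriv i h y := by
  rw [partialDeriv, partialDeriv, e.fderiv_eq]

lemma partialDeriv_eventuallyEq (i : Fin n) (e : f =ᶠ[𝓝 y] h) :
    partialDeriv i f =ᶠ[𝓝 y] partialDeriv i h :=
  e.eventuallyEq_nhds.mono fun _ hz ↦ partialDeriv_congr i hz

lemma partialDeriv_const (i : Fin n) (c : ℝ) : partialDeriv i (fun _ : Euc n ↦ c) y = 0 := by
  simp [partialDeriv]

lemma partialDeriv_add (i : Fin n) (hf : DifferentiableAt ℝ f y) (hh : DifferentiableAt ℝ h y) :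
    partialDeriv i (fun z ↦ f z + h z) y = partialDeriv i f y + partialDeriv i h y := by
  simp [partialDeriv, fderiv_fun_add hf hh]

lemma partialDeriv_mul (i : Fin n) (hf : DifferentiableAt ℝ f y) (hh : DifferentiableAt ℝ h y) :
    partialDeriv i (fun z ↦ f z * h z) y
      = partialDeriv i f y * h y + f y * partialDeriv i h y := by
  simp [partialDeriv, fderiv_fun_mul hf hh, mul_comm, add_comm]

lemma partialDeriv_sum {ι : Type*} (s : Finset ι) (i : Fin n) {F : ι → Euc n → ℝ}
    (hF : ∀ a ∈ s, DifferentiableAt ℝ (F a) y) :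
    partialDeriv i (fun z ↦ ∑ a ∈ s, F a z) y = ∑ a ∈ s, partialDeriv i (F a) y := by
  simp [partialDeriv, fderiv_fun_sum hF]

lemma partialDeriv_sum_mul {ι : Type*} (s : Finset ι) (i : Fin n) {F H : ι → Euc n → ℝ}
    (hF : ∀ a ∈ s, DifferentiableAt ℝ (F a) y) (hH : ∀ a ∈ s, DifferentiableAt ℝ (H a) y) :
    partialDeriv i (fun z ↦ ∑ a ∈ s, F a z * H a z) y
      = ∑ a ∈ s, (partialDeriv i (F a) y * H a y + F a y * partialDeriv i (H a) y) := by
  rw [partialDeriv_sum s i fun a ha ↦ (hF a ha).fun_mul (hH a ha)]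
  exact Finset.sum_congr rfl fun a ha ↦ partialDeriv_mul i (hF a ha) (hH a ha)

lemma partialDeriv_comp_real (i : Fin n) {H : ℝ → ℝ} {H' : ℝ} (hH : HasDerivAt H H' (f y))
    (hf : DifferentiableAt ℝ f y) :
    partialDeriv i (fun z ↦ H (f z)) y = H' * partialDeriv i f y := by
  change fderiv ℝ (H ∘ f) y _ = _
  rw [(hH.comp_hasFDerivAt y hf.hasFDerivAt).fderiv]
  rfl

lemma fderiv_apply_eq_sum (v : Euc n) :
    fderiv ℝ f y v = ∑ i, partialDeriv i f y * v i := by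
  conv_lhs => rw [← (EuclideanSpace.basisFun (Fin n) ℝ).sum_repr v]
  simp [partialDeriv, mul_comm]

lemma contDiffAt_partialDeriv {r k : WithTop ℕ∞} (hf : ContDiffAt ℝ k f y) (hrk : r + 1 ≤ k)
    (i : Fin n) : ContDiffAt ℝ r (partialDeriv i f) y :=
  (hf.fderiv_right hrk).clm_apply contDiffAt_const

lemma differentiableAt_partialDeriv (hf : ContDiffAt ℝ 2 f y) (i : Fin n) :
    DifferentiableAt ℝ (partialDeriv i f) y :=
  (contDiffAt_partialDeriv (r := 1) hf (by norm_num) i).differentiableAt one_ne_zero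

lemma partialDeriv_comm (hf : ContDiffAt ℝ 2 f y) (i j : Fin n) :
    partialDeriv i (partialDeriv j f) y = partialDeriv j (partialDeriv i f) y := by
  have hd : DifferentiableAt ℝ (fderiv ℝ f) y :=
    (hf.fderiv_right (m := 1) (by norm_num)).differentiableAt one_ne_zero
  have eq_snd_fderiv (i j : Fin n) : partialDeriv i (partialDeriv j f) y
      = fderiv ℝ (fderiv ℝ f) y (EuclideanSpace.single i 1) (EuclideanSpace.single j 1) := by
    change fderiv ℝ (fun z ↦ fderiv ℝ f z (EuclideanSpace.single j 1)) y _ = _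
    simp [fderiv_clm_apply hd (differentiableAt_const _)]
  rw [eq_snd_fderiv, eq_snd_fderiv]
  exact (hf.isSymmSndFDerivAt (by simp)).eq _ _

end PartialDeriv

/-! ### Matrices -/

section Matrix

variable {ι : Type*} [Fintype ι]

lemma sq_trace_le_card_mul_trace_sq {S : Matrix ι ι ℝ} (hS : Sᵀ = S) :
    S.trace ^ 2 ≤ Fintype.card ι * (S * S).trace := by
  have diag_le : ∑ i, S i i ^ 2 ≤ (S * S).trace := by
    refine Finset.sum_le_sum fun i _ ↦ ?_
    have row : (S * S) i i = ∑ j, S i j ^ 2 := by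
      rw [Matrix.mul_apply]
      exact Finset.sum_congr rfl fun j _ ↦ by rw [← congrFun₂ hS i j, Matrix.transpose_apply, sq]
    rw [Matrix.diag_apply, row]
    exact Finset.single_le_sum (f := fun j ↦ S i j ^ 2) (fun j _ ↦ sq_nonneg _)
      (Finset.mem_univ i)
  calc S.trace ^ 2 ≤ Fintype.card ι * ∑ i, S i i ^ 2 :=
        sq_sum_le_card_mul_sum_sq (s := Finset.univ) (f := fun i ↦ S i i)
    _ ≤ Fintype.card ι * (S * S).trace := by gcongr

lemma sq_trace_posSemidef_mul_le {P S : Matrix ι ι ℝ} (hP : P.PosSemidef) (hS : Sᵀ = S) :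
    (P * S).trace ^ 2 ≤ Fintype.card ι * (P * S * (P * S)).trace := by
  classical
  obtain ⟨B, rfl⟩ : ∃ B : Matrix ι ι ℝ, P = Bᵀ * B := by
    open scoped MatrixOrder Matrix.Norms.L2Operator in
    obtain ⟨B, hB⟩ := CStarAlgebra.nonneg_iff_eq_star_mul_self.mp hP.nonneg
    exact ⟨B, by simpa [Matrix.star_eq_conjTranspose] using hB⟩
  have conj_symm : (B * S * Bᵀ)ᵀ = B * S * Bᵀ := by
    simp only [Matrix.transpose_mul, Matrix.transpose_transpose, hS, Matrix.mul_assoc]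
  have trace_conj : (Bᵀ * B * S).trace = (B * S * Bᵀ).trace := by
    rw [Matrix.mul_assoc, Matrix.trace_mul_comm]
  have trace_conj_sq :
      (Bᵀ * B * S * (Bᵀ * B * S)).trace = (B * S * Bᵀ * (B * S * Bᵀ)).trace := by
    rw [show Bᵀ * B * S * (Bᵀ * B * S) = Bᵀ * (B * S * Bᵀ * (B * S)) by noncomm_ring,
      Matrix.trace_mul_comm]
    noncomm_ring
  rw [trace_conj, trace_conj_sq]
  exact sq_trace_le_card_mul_trace_sq conj_symm

lemma trace_mul_adjugate [DecidableEq ι] (A B : Matrix ι ι ℝ) :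
    (B * A.adjugate).trace = ∑ i, (A.updateRow i (B i)).det := by
  refine Finset.sum_congr rfl fun i _ ↦ ?_
  rw [← Matrix.cramer_transpose_apply, Matrix.cramer_eq_adjugate_mulVec,
    ← Matrix.adjugate_transpose]
  exact Finset.sum_congr rfl fun j _ ↦ mul_comm _ _

end Matrix

section MatrixCalculus

variable {ι : Type*} [Fintype ι] [DecidableEq ι]

lemma contDiffAt_det {E : Type*} [NormedAddCommGroup E] [NormedSpace ℝ E]
    {A : E → Matrix ι ι ℝ} {y : E} {k : WithTop ℕ∞}
    (hA : ∀ i j, ContDiffAt ℝ k (fun z ↦ A z i j) y) :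
    ContDiffAt ℝ k (fun z ↦ (A z).det) y := by
  simp only [Matrix.det_apply]
  exact ContDiffAt.sum fun σ _ ↦ (contDiffAt_prod fun i _ ↦ hA _ _).const_smul _

lemma contDiffAt_inv {E : Type*} [NormedAddCommGroup E] [NormedSpace ℝ E]
    {A : E → Matrix ι ι ℝ} {y : E} {k : WithTop ℕ∞}
    (hA : ∀ i j, ContDiffAt ℝ k (fun z ↦ A z i j) y) (hdet : (A y).det ≠ 0) (i j : ι) :
    ContDiffAt ℝ k (fun z ↦ (A z)⁻¹ i j) y := by
  simp only [Matrix.inv_def, Ring.inverse_eq_inv', Matrix.smul_apply, Matrix.adjugate_apply,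
    smul_eq_mul]
  refine ((contDiffAt_det hA).inv hdet).mul (contDiffAt_det fun a b ↦ ?_)
  obtain rfl | h := eq_or_ne a j
  · simpa using contDiffAt_const
  · simpa [Matrix.updateRow_ne h] using hA a b

lemma partialDeriv_det {A : Euc n → Matrix ι ι ℝ} {y : Euc n}
    (hA : ∀ i j, DifferentiableAt ℝ (fun z ↦ A z i j) y) (l : Fin n) :
    partialDeriv l (fun z ↦ (A z).det) y
      = (Matrix.of (fun i j ↦ partialDeriv l (fun z ↦ A z i j) y) * (A y).adjugate).trace := by
  let detRows : ContinuousMultilinearMap ℝ (fun _ : ι ↦ ι → ℝ) ℝ :=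
    { toMultilinearMap := (Matrix.detRowAlternating (R := ℝ) (n := ι)).toMultilinearMap
      cont := Continuous.matrix_det (A := fun M : ι → ι → ℝ ↦ Matrix.of M) continuous_id }
  have hasFDerivAt_rows : HasFDerivAt (fun z ↦ (A z : ι → ι → ℝ))
      (ContinuousLinearMap.pi fun i ↦ ContinuousLinearMap.pi fun j ↦
        fderiv ℝ (fun z ↦ A z i j) y) y :=
    hasFDerivAt_pi.2 fun i ↦ hasFDerivAt_pi.2 fun j ↦ (hA i j).hasFDerivAt
  have hasFDerivAt_det := (detRows.hasFDerivAt (A y)).comp y hasFDerivAt_rows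
  rw [trace_mul_adjugate]
  change fderiv ℝ (detRows ∘ fun z ↦ (A z : ι → ι → ℝ)) y _ = _
  rw [hasFDerivAt_det.fderiv]
  exact ContinuousMultilinearMap.linearDeriv_apply detRows _ _

end MatrixCalculus

/-! ### Riemannian metrics on open subsets of `ℝⁿ` -/

/-- `G` is the matrix field of a smooth Riemannian metric on the open set `U`. -/
structure IsMetricOn (G : Euc n → Matrix (Fin n) (Fin n) ℝ) (U : Set (Euc n)) : Prop where
  isOpen : IsOpen U
  contDiffAt : ∀ y ∈ U, ∀ i j, ContDiffAt ℝ ∞ (fun z ↦ G z i j) y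
  posDef : ∀ y ∈ U, (G y).PosDef

/-- The matrix `(∂_k G_ij)_ij`. -/
def derivMatrix (G : Euc n → Matrix (Fin n) (Fin n) ℝ) (k : Fin n) (y : Euc n) :
    Matrix (Fin n) (Fin n) ℝ :=
  Matrix.of fun i j ↦ partialDeriv k (fun z ↦ G z i j) y

/-- The connection matrix `(Γ^l_ki)_li`. -/
def connMatrix (G : Euc n → Matrix (Fin n) (Fin n) ℝ) (k : Fin n) (y : Euc n) :
    Matrix (Fin n) (Fin n) ℝ :=
  Matrix.of fun l i ↦ christoffel G l k i y

/-- The Christoffel symbols of the first kind,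
`Γ_lij = 1/2 (∂_i G_jl + ∂_j G_il - ∂_l G_ij)`. -/
def christoffelFirst (G : Euc n → Matrix (Fin n) (Fin n) ℝ) (l i j : Fin n) (y : Euc n) : ℝ :=
  (1 / 2) * (derivMatrix G i y j l + derivMatrix G j y i l - derivMatrix G l y i j)

/-- The Riemannian volume density `√(det G)`. -/
def volDensity (G : Euc n → Matrix (Fin n) (Fin n) ℝ) (y : Euc n) : ℝ := √(G y).det

namespace IsMetricOn

variable {G : Euc n → Matrix (Fin n) (Fin n) ℝ} {U : Set (Euc n)} (hG : IsMetricOn G U)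
  {y : Euc n} (hy : y ∈ U)

include hG hy

lemma mem_nhds : U ∈ 𝓝 y := hG.isOpen.mem_nhds hy

lemma det_pos : 0 < (G y).det := (hG.posDef y hy).det_pos

lemma mul_inv : G y * (G y)⁻¹ = 1 := Matrix.mul_nonsing_inv _ (hG.det_pos hy).ne'.isUnit

lemma inv_mul : (G y)⁻¹ * G y = 1 := Matrix.nonsing_inv_mul _ (hG.det_pos hy).ne'.isUnit

lemma transpose_eq : (G y)ᵀ = G y := by
  simpa using (hG.posDef y hy).isHermitian.eq

lemma symm (i j : Fin n) : G y i j = G y j i :=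
  congrFun₂ (hG.transpose_eq hy) j i

lemma inv_symm (i j : Fin n) : (G y)⁻¹ i j = (G y)⁻¹ j i := by
  have inv_transpose : ((G y)⁻¹)ᵀ = (G y)⁻¹ := by
    rw [Matrix.transpose_nonsing_inv, hG.transpose_eq hy]
  exact congrFun₂ inv_transpose j i

lemma contDiffAt_inv (i j : Fin n) : ContDiffAt ℝ ∞ (fun z ↦ (G z)⁻¹ i j) y :=
  LocalGeometry.contDiffAt_inv (hG.contDiffAt y hy) (hG.det_pos hy).ne' i j

lemma differentiableAt (i j : Fin n) : DifferentiableAt ℝ (fun z ↦ G z i j) y :=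
  (hG.contDiffAt y hy i j).differentiableAt (by simp)

lemma differentiableAt_inv (i j : Fin n) : DifferentiableAt ℝ (fun z ↦ (G z)⁻¹ i j) y :=
  (hG.contDiffAt_inv hy i j).differentiableAt (by simp)

lemma contDiffAt_volDensity : ContDiffAt ℝ ∞ (volDensity G) y :=
  (contDiffAt_det (hG.contDiffAt y hy)).sqrt (hG.det_pos hy).ne'

lemma volDensity_pos : 0 < volDensity G y := Real.sqrt_pos.2 (hG.det_pos hy)

lemma contDiffAt_christoffel (k i j : Fin n) : ContDiffAt ℝ ∞ (christoffel G k i j) y := by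
  have deriv_metric (a b c : Fin n) : ContDiffAt ℝ ∞ (partialDeriv a fun z ↦ G z b c) y :=
    contDiffAt_partialDeriv (hG.contDiffAt y hy b c) (by simp) a
  exact contDiffAt_const.mul (ContDiffAt.sum fun l _ ↦ (hG.contDiffAt_inv hy k l).mul
    (((deriv_metric i j l).add (deriv_metric j i l)).sub (deriv_metric l i j)))

lemma differentiableAt_christoffel (k i j : Fin n) :
    DifferentiableAt ℝ (christoffel G k i j) y :=
  (hG.contDiffAt_christoffel hy k i j).differentiableAt (by simp)

lemma derivMatrix_symm (k i j : Fin n) : derivMatrix G k y i j = derivMatrix G k y j i := by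
  refine partialDeriv_congr k ?_
  filter_upwards [hG.mem_nhds hy] with z hz using hG.symm hz i j

lemma christoffel_symm (k i j : Fin n) : christoffel G k i j y = christoffel G k j i y := by
  have deriv_symm (l : Fin n) : partialDeriv l (fun z ↦ G z i j) y
      = partialDeriv l (fun z ↦ G z j i) y := hG.derivMatrix_symm hy l i j
  simp only [christoffel, deriv_symm, add_comm (partialDeriv i _ y)]

lemma sum_metric_mul_christoffel (l i j : Fin n) :
    ∑ k, G y l k * christoffel G k i j y = christoffelFirst G l i j y := by
  have raise (k : Fin n) : christoffel G k i j y
      = ((G y)⁻¹ *ᵥ fun l ↦ christoffelFirst G l i j y) k := by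
    simp only [christoffel, Matrix.mulVec, dotProduct, christoffelFirst, derivMatrix,
      Matrix.of_apply, Finset.mul_sum]
    exact Finset.sum_congr rfl fun l _ ↦ by ring
  calc ∑ k, G y l k * christoffel G k i j y
      = (G y *ᵥ ((G y)⁻¹ *ᵥ fun l ↦ christoffelFirst G l i j y)) l :=
        Finset.sum_congr rfl fun k _ ↦ by rw [raise]
    _ = christoffelFirst G l i j y := by
        rw [Matrix.mulVec_mulVec, hG.mul_inv hy, Matrix.one_mulVec]

lemma derivMatrix_eq_connMatrix (k : Fin n) :
    derivMatrix G k y = G y * connMatrix G k y + (connMatrix G k y)ᵀ * G y := by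
  ext i j
  have lower (i j : Fin n) : (G y * connMatrix G k y) i j = christoffelFirst G i k j y :=
    hG.sum_metric_mul_christoffel hy i k j
  have transpose_mul : (connMatrix G k y)ᵀ * G y = (G y * connMatrix G k y)ᵀ := by
    rw [Matrix.transpose_mul, hG.transpose_eq hy]
  rw [transpose_mul, Matrix.add_apply, Matrix.transpose_apply, lower, lower, christoffelFirst,
    christoffelFirst, hG.derivMatrix_symm hy k j i]
  ring

lemma derivMatrix_inv_eq (k : Fin n) :
    derivMatrix (fun z ↦ (G z)⁻¹) k y = -((G y)⁻¹ * derivMatrix G k y * (G y)⁻¹) := by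
  have product_rule :
      derivMatrix G k y * (G y)⁻¹ + G y * derivMatrix (fun z ↦ (G z)⁻¹) k y = 0 := by
    ext i j
    have mul_inv_const : (fun z ↦ ∑ l, G z i l * (G z)⁻¹ l j) =ᶠ[𝓝 y]
        fun _ ↦ (1 : Matrix (Fin n) (Fin n) ℝ) i j := by
      filter_upwards [hG.mem_nhds hy] with z hz using congrFun₂ (hG.mul_inv hz) i j
    have deriv_eq_zero := partialDeriv_congr k mul_inv_const
    rw [partialDeriv_const, partialDeriv_sum_mul _ _ (fun l _ ↦ hG.differentiableAt hy i l)
      fun l _ ↦ hG.differentiableAt_inv hy l j, Finset.sum_add_distrib] at deriv_eq_zero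
    exact deriv_eq_zero
  rw [eq_neg_iff_add_eq_zero, add_comm]
  simpa [Matrix.mul_add, ← Matrix.mul_assoc, hG.inv_mul hy] using
    congrArg (fun X ↦ (G y)⁻¹ * X) product_rule

lemma partialDeriv_inv (k i j : Fin n) :
    partialDeriv k (fun z ↦ (G z)⁻¹ i j) y
      = -(∑ l, christoffel G i k l y * (G y)⁻¹ l j)
        - ∑ l, (G y)⁻¹ i l * christoffel G j k l y := by
  have matrix_form : derivMatrix (fun z ↦ (G z)⁻¹) k y
      = -(connMatrix G k y * (G y)⁻¹) - (G y)⁻¹ * (connMatrix G k y)ᵀ := by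
    calc derivMatrix (fun z ↦ (G z)⁻¹) k y
        = -((G y)⁻¹ * G y * connMatrix G k y * (G y)⁻¹
            + (G y)⁻¹ * (connMatrix G k y)ᵀ * (G y * (G y)⁻¹)) := by
          rw [hG.derivMatrix_inv_eq hy, hG.derivMatrix_eq_connMatrix hy]
          noncomm_ring
      _ = _ := by
          rw [hG.inv_mul hy, hG.mul_inv hy]
          noncomm_ring
  exact congrFun₂ matrix_form i j

lemma partialDeriv_det_metric (k : Fin n) :
    partialDeriv k (fun z ↦ (G z).det) y = 2 * (G y).det * ∑ l, christoffel G l l k y := by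
  have trace_conn : (connMatrix G k y).trace = ∑ l, christoffel G l l k y :=
    Finset.sum_congr rfl fun l _ ↦ hG.christoffel_symm hy l k l
  rw [partialDeriv_det (hG.differentiableAt hy)]
  change (derivMatrix G k y * (G y).adjugate).trace = _
  rw [hG.derivMatrix_eq_connMatrix hy, Matrix.add_mul, Matrix.trace_add, Matrix.mul_assoc,
    Matrix.mul_assoc, Matrix.mul_adjugate, Matrix.trace_mul_comm (G y), Matrix.mul_assoc,
    Matrix.adjugate_mul, ← trace_conn]
  simp only [Matrix.mul_smul, Matrix.mul_one, Matrix.trace_smul, Matrix.trace_transpose,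
    smul_eq_mul]
  ring

lemma partialDeriv_volDensity (k : Fin n) :
    partialDeriv k (volDensity G) y = volDensity G y * ∑ l, christoffel G l l k y := by
  have hpos := hG.volDensity_pos hy
  have hsq : volDensity G y ^ 2 = (G y).det := Real.sq_sqrt (hG.det_pos hy).le
  calc partialDeriv k (volDensity G) y
      = 1 / (2 * volDensity G y) * (2 * (G y).det * ∑ l, christoffel G l l k y) := by
        rw [← hG.partialDeriv_det_metric hy]
        exact partialDeriv_comp_real k (Real.hasDerivAt_sqrt (hG.det_pos hy).ne')
          ((contDiffAt_det (hG.contDiffAt y hy)).differentiableAt (by simp))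
    _ = volDensity G y * ∑ l, christoffel G l l k y := by
        rw [← hsq]
        field_simp

end IsMetricOn

/-! ### The Bochner formula -/

/-- The component `∇_i X^k = ∂_i X^k + ∑_p Γ^k_ip X^p` of the covariant derivative of a vector
field. -/
def covDeriv (G : Euc n → Matrix (Fin n) (Fin n) ℝ) (X : Fin n → Euc n → ℝ) (i k : Fin n)
    (y : Euc n) : ℝ :=
  partialDeriv i (X k) y + ∑ p, christoffel G k i p y * X p y

/-- The divergence `∑_k ∇_k X^k` of a vector field. -/
def divergence (G : Euc n → Matrix (Fin n) (Fin n) ℝ) (X : Fin n → Euc n → ℝ) (y : Euc n) : ℝ :=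
  ∑ k, covDeriv G X k k y

/-- The components `∑_j G^ij ∂_j f` of the gradient vector field. -/
def grad (G : Euc n → Matrix (Fin n) (Fin n) ℝ) (f : Euc n → ℝ) (i : Fin n) (y : Euc n) : ℝ :=
  ∑ j, (G y)⁻¹ i j * partialDeriv j f y

/-- The inner product `⟨∇f, ∇h⟩ = ∑_ij G^ij ∂_i f ∂_j h`. -/
def gradInner (G : Euc n → Matrix (Fin n) (Fin n) ℝ) (f h : Euc n → ℝ) (y : Euc n) : ℝ :=
  ∑ i, partialDeriv i f y * grad G h i y

/-- The Bakry–Émery curvature-dimension condition `CD(K, n)` at the point `y`. It only involves the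
operators `Δ` and `⟨∇·, ∇·⟩`, which makes it simpler to transport between charts than the Ricci
tensor. -/
def CurvatureDimensionAt (G : Euc n → Matrix (Fin n) (Fin n) ℝ) (K : ℝ) (y : Euc n) : Prop :=
  ∀ f : Euc n → ℝ, ContDiffAt ℝ 3 f y →
    laplacian G f y ^ 2 / n + K * gradInner G f f y
      ≤ laplacian G (gradInner G f f) y / 2 - gradInner G f (laplacian G f) y

lemma divergence_congr {G : Euc n → Matrix (Fin n) (Fin n) ℝ} {X Y : Fin n → Euc n → ℝ}
    {y : Euc n} (e : ∀ k, X k =ᶠ[𝓝 y] Y k) : divergence G X y = divergence G Y y := by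
  simp only [divergence, covDeriv, partialDeriv_congr _ (e _), (e _).eq_of_nhds]

lemma divergence_const_mul {G : Euc n → Matrix (Fin n) (Fin n) ℝ} {X : Fin n → Euc n → ℝ}
    {y : Euc n} (c : ℝ) (hX : ∀ k, DifferentiableAt ℝ (X k) y) :
    divergence G (fun k z ↦ c * X k z) y = c * divergence G X y := by
  simp only [divergence, covDeriv, Finset.mul_sum, mul_add]
  simp only [partialDeriv_mul _ (differentiableAt_const c) (hX _), partialDeriv_const, zero_mul,
    zero_add, mul_left_comm c]

namespace IsMetricOn

variable {G : Euc n → Matrix (Fin n) (Fin n) ℝ} {U : Set (Euc n)} (hG : IsMetricOn G U)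
  {y : Euc n} (hy : y ∈ U)

include hG hy

section VectorField

variable {X : Fin n → Euc n → ℝ}

lemma differentiableAt_covDeriv (hX : ∀ k, ContDiffAt ℝ 2 (X k) y) (i k : Fin n) :
    DifferentiableAt ℝ (covDeriv G X i k) y :=
  (differentiableAt_partialDeriv (hX k) i).fun_add (DifferentiableAt.fun_sum fun p _ ↦
    (hG.differentiableAt_christoffel hy k i p).fun_mul ((hX p).differentiableAt two_ne_zero))

lemma partialDeriv_covDeriv (hX : ∀ k, ContDiffAt ℝ 2 (X k) y) (j i k : Fin n) :
    partialDeriv j (covDeriv G X i k) y = partialDeriv j (partialDeriv i (X k)) y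
      + ∑ p, (partialDeriv j (christoffel G k i p) y * X p y
        + christoffel G k i p y * partialDeriv j (X p) y) := by
  have hΓ (p : Fin n) := hG.differentiableAt_christoffel hy k i p
  have hX' (p : Fin n) := (hX p).differentiableAt two_ne_zero
  rw [← partialDeriv_sum_mul _ j (fun p _ ↦ hΓ p) fun p _ ↦ hX' p]
  exact partialDeriv_add j (differentiableAt_partialDeriv (hX k) i)
    (DifferentiableAt.fun_sum fun p _ ↦ (hΓ p).fun_mul (hX' p))

lemma sum_ricci_mul (i : Fin n) :
    ∑ j, ricci G j i y * X j y
      = ∑ k, ∑ p, (partialDeriv k (christoffel G k i p) y * X p y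
          - partialDeriv i (christoffel G k k p) y * X p y)
        + ∑ k, ∑ l, (christoffel G k k l y * ∑ p, christoffel G l i p y * X p y
          - christoffel G l k i y * ∑ p, christoffel G k l p y * X p y) := by
  have deriv_symm (k j : Fin n) :
      partialDeriv k (christoffel G k j i) y = partialDeriv k (christoffel G k i j) y := by
    refine partialDeriv_congr k ?_
    filter_upwards [hG.mem_nhds hy] with z hz using hG.christoffel_symm hz k j i
  have quadratic_part (j : Fin n) :
      ∑ k, ∑ l, (christoffel G k k l y * christoffel G l j i y
        - christoffel G k i l y * christoffel G l k j y)
      = ∑ k, ∑ l, (christoffel G k k l y * christoffel G l i j y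
        - christoffel G l k i y * christoffel G k l j y) := by
    simp only [Finset.sum_sub_distrib, hG.christoffel_symm hy _ i]
    congr 1
    exact Finset.sum_comm
  simp only [ricci, quadratic_part, deriv_symm, add_mul, Finset.sum_mul, Finset.sum_add_distrib]
  congr 1
  · rw [Finset.sum_comm]
    exact Finset.sum_congr rfl fun k _ ↦ Finset.sum_congr rfl fun p _ ↦ sub_mul _ _ _
  · rw [Finset.sum_comm]
    refine Finset.sum_congr rfl fun k _ ↦ ?_
    rw [Finset.sum_comm]
    refine Finset.sum_congr rfl fun l _ ↦ ?_
    rw [Finset.mul_sum, Finset.mul_sum, ← Finset.sum_sub_distrib]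
    exact Finset.sum_congr rfl fun p _ ↦ by ring

/-- The contracted Ricci identity `∇_k ∇_i X^k - ∇_i ∇_k X^k = Ric_ij X^j`; the last sum appears
because only the index `k` of `∇_i X^k` is differentiated covariantly by `divergence`. -/
lemma divergence_covDeriv (hX : ∀ k, ContDiffAt ℝ 2 (X k) y) (i : Fin n) :
    divergence G (covDeriv G X i) y = partialDeriv i (divergence G X) y
      + ∑ j, ricci G j i y * X j y + ∑ k, ∑ l, christoffel G l k i y * covDeriv G X l k y := by
  have relabel : ∑ k, ∑ p, christoffel G k i p y * partialDeriv k (X p) y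
      = ∑ k, ∑ l, christoffel G l k i y * partialDeriv l (X k) y := by
    rw [Finset.sum_comm]
    exact Finset.sum_congr rfl fun k _ ↦ Finset.sum_congr rfl fun l _ ↦ by
      rw [hG.christoffel_symm hy l i k]
  have deriv_divergence : partialDeriv i (divergence G X) y
      = ∑ k, partialDeriv i (covDeriv G X k k) y :=
    partialDeriv_sum _ i fun k _ ↦ hG.differentiableAt_covDeriv hy hX k k
  have expand : divergence G (covDeriv G X i) y = ∑ k, (partialDeriv k (covDeriv G X i k) y
      + ∑ l, christoffel G k k l y * covDeriv G X i l y) := rfl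
  rw [expand, deriv_divergence, hG.sum_ricci_mul hy]
  simp only [hG.partialDeriv_covDeriv hy hX, partialDeriv_comm (hX _) i]
  simp only [covDeriv, mul_add, Finset.sum_add_distrib, Finset.sum_sub_distrib, relabel]
  ring

omit hG hy in
lemma divergence_sum_mul {a : Fin n → Euc n → ℝ} {V : Fin n → Fin n → Euc n → ℝ}
    (ha : ∀ i, DifferentiableAt ℝ (a i) y) (hV : ∀ i k, DifferentiableAt ℝ (V i k) y) :
    divergence G (fun k z ↦ ∑ i, a i z * V i k z) y
      = ∑ i, a i y * divergence G (V i) y + ∑ k, ∑ i, partialDeriv k (a i) y * V i k y := by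
  have connection_part (k : Fin n) : ∑ p, christoffel G k k p y * ∑ i, a i y * V i p y
      = ∑ i, a i y * ∑ p, christoffel G k k p y * V i p y := by
    simp only [Finset.mul_sum]
    rw [Finset.sum_comm]
    exact Finset.sum_congr rfl fun i _ ↦ Finset.sum_congr rfl fun p _ ↦ mul_left_comm _ _ _
  have divergence_part : ∑ i, a i y * divergence G (V i) y
      = ∑ k, ∑ i, a i y * covDeriv G (V i) k k y := by
    simp only [divergence, Finset.mul_sum]
    exact Finset.sum_comm
  rw [divergence_part, divergence, ← Finset.sum_add_distrib]
  refine Finset.sum_congr rfl fun k _ ↦ ?_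
  rw [covDeriv, partialDeriv_sum_mul _ k (fun i _ ↦ ha i) fun i _ ↦ hV i k, connection_part,
    ← Finset.sum_add_distrib, ← Finset.sum_add_distrib]
  exact Finset.sum_congr rfl fun i _ ↦ by rw [covDeriv]; ring

/-- The Bochner formula for vector fields,
`div (∇_X X) = X (div X) + tr ((∇X)²) + Ric (X, X)`. -/
lemma divergence_covDeriv_self (hX : ∀ k, ContDiffAt ℝ 2 (X k) y) :
    divergence G (fun k z ↦ ∑ i, X i z * covDeriv G X i k z) y
      = ∑ i, X i y * partialDeriv i (divergence G X) y
        + ∑ k, ∑ i, covDeriv G X k i y * covDeriv G X i k y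
        + ∑ i, ∑ j, ricci G i j y * X i y * X j y := by
  have ricci_term : ∑ i, X i y * ∑ j, ricci G j i y * X j y
      = ∑ i, ∑ j, ricci G i j y * X i y * X j y := by
    simp only [Finset.mul_sum]
    rw [Finset.sum_comm]
    exact Finset.sum_congr rfl fun i _ ↦ Finset.sum_congr rfl fun j _ ↦ by ring
  have square_term : ∑ k, ∑ i, covDeriv G X k i y * covDeriv G X i k y
      = ∑ k, ∑ i, partialDeriv k (X i) y * covDeriv G X i k y
        + ∑ i, X i y * ∑ k, ∑ l, christoffel G l k i y * covDeriv G X l k y := by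
    have connection_part :
        ∑ k, ∑ i, (∑ p, christoffel G i k p y * X p y) * covDeriv G X i k y
          = ∑ p, X p y * ∑ k, ∑ i, christoffel G i k p y * covDeriv G X i k y := by
      simp only [Finset.mul_sum, Finset.sum_mul]
      rw [Finset.sum_congr rfl fun k _ ↦ Finset.sum_comm, Finset.sum_comm]
      exact Finset.sum_congr rfl fun p _ ↦ Finset.sum_congr rfl fun k _ ↦
        Finset.sum_congr rfl fun i _ ↦ by ring
    rw [← connection_part, ← Finset.sum_add_distrib]
    refine Finset.sum_congr rfl fun k _ ↦ ?_
    rw [← Finset.sum_add_distrib]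
    exact Finset.sum_congr rfl fun i _ ↦ by unfold covDeriv; ring
  rw [divergence_sum_mul (fun i ↦ (hX i).differentiableAt two_ne_zero)
    fun i k ↦ hG.differentiableAt_covDeriv hy hX i k]
  simp only [hG.divergence_covDeriv hy hX, mul_add, Finset.sum_add_distrib, ricci_term,
    square_term]
  ring

end VectorField

variable {f h : Euc n → ℝ}

lemma contDiffAt_grad {r k : WithTop ℕ∞} (hf : ContDiffAt ℝ k f y) (hrk : r + 1 ≤ k)
    (hr : r ≤ ∞) (i : Fin n) : ContDiffAt ℝ r (grad G f i) y :=
  ContDiffAt.sum fun j _ ↦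
    ((hG.contDiffAt_inv hy i j).of_le hr).mul (contDiffAt_partialDeriv hf hrk j)

lemma differentiableAt_grad (hf : ContDiffAt ℝ 2 f y) (i : Fin n) :
    DifferentiableAt ℝ (grad G f i) y :=
  (hG.contDiffAt_grad (r := 1) hy hf (by norm_num) (by simp) i).differentiableAt one_ne_zero

lemma contDiffAt_gradInner {r k : WithTop ℕ∞} (hf : ContDiffAt ℝ k f y) (hh : ContDiffAt ℝ k h y)
    (hrk : r + 1 ≤ k) (hr : r ≤ ∞) : ContDiffAt ℝ r (gradInner G f h) y :=
  ContDiffAt.sum fun i _ ↦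
    (contDiffAt_partialDeriv hf hrk i).mul (hG.contDiffAt_grad hy hh hrk hr i)

lemma contDiffAt_hessian {r k : WithTop ℕ∞} (hf : ContDiffAt ℝ k f y) (hrk : r + 1 + 1 ≤ k)
    (hr : r ≤ ∞) (i j : Fin n) : ContDiffAt ℝ r (hessian G f i j) y := by
  have hrk' : r + 1 ≤ k := le_self_add.trans hrk
  exact (contDiffAt_partialDeriv (contDiffAt_partialDeriv hf hrk j) le_rfl i).sub
    (ContDiffAt.sum fun l _ ↦ ((hG.contDiffAt_christoffel hy l i j).of_le hr).mul
      (contDiffAt_partialDeriv hf hrk' l))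

lemma contDiffAt_laplacian {r k : WithTop ℕ∞} (hf : ContDiffAt ℝ k f y)
    (hrk : r + 1 + 1 ≤ k) (hr : r ≤ ∞) : ContDiffAt ℝ r (laplacian G f) y :=
  ContDiffAt.sum fun i _ ↦ ContDiffAt.sum fun j _ ↦
    ((hG.contDiffAt_inv hy i j).of_le hr).mul (hG.contDiffAt_hessian hy hf hrk hr i j)

lemma hessian_symm (hf : ContDiffAt ℝ 2 f y) (i j : Fin n) :
    hessian G f i j y = hessian G f j i y := by
  simp only [hessian, partialDeriv_comm hf i j, hG.christoffel_symm hy _ i j]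

lemma gradInner_eq_sum_grad_mul :
    gradInner G f h y = ∑ i, grad G f i y * partialDeriv i h y := by
  simp only [gradInner, grad, Finset.mul_sum, Finset.sum_mul]
  rw [Finset.sum_comm]
  exact Finset.sum_congr rfl fun i _ ↦ Finset.sum_congr rfl fun j _ ↦ by
    rw [hG.inv_symm hy i j]; ring

lemma gradInner_comm : gradInner G f h y = gradInner G h f y := by
  rw [hG.gradInner_eq_sum_grad_mul hy]
  exact Finset.sum_congr rfl fun i _ ↦ mul_comm _ _

lemma covDeriv_grad (hf : ContDiffAt ℝ 2 f y) (i k : Fin n) :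
    covDeriv G (grad G f) i k y = ∑ j, (G y)⁻¹ k j * hessian G f i j y := by
  have deriv_grad : partialDeriv i (grad G f k) y
      = ∑ j, (partialDeriv i (fun z ↦ (G z)⁻¹ k j) y * partialDeriv j f y
        + (G y)⁻¹ k j * partialDeriv i (partialDeriv j f) y) :=
    partialDeriv_sum_mul _ i (fun j _ ↦ hG.differentiableAt_inv hy k j)
      fun j _ ↦ differentiableAt_partialDeriv hf j
  have cancelled : ∑ p, christoffel G k i p y * grad G f p y
      = ∑ j, ∑ l, christoffel G k i l y * (G y)⁻¹ l j * partialDeriv j f y := by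
    simp only [grad, Finset.mul_sum, mul_assoc]
    exact Finset.sum_comm
  have remaining : ∑ j, ∑ l, (G y)⁻¹ k l * christoffel G j i l y * partialDeriv j f y
      = ∑ l, ∑ j, (G y)⁻¹ k l * (christoffel G j i l y * partialDeriv j f y) := by
    simp only [mul_assoc]
    exact Finset.sum_comm
  rw [covDeriv, deriv_grad, cancelled]
  simp only [hG.partialDeriv_inv hy, hessian, mul_sub, sub_mul, neg_mul, Finset.sum_add_distrib,
    Finset.sum_sub_distrib, Finset.mul_sum, Finset.sum_mul, Finset.sum_neg_distrib, remaining]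
  ring

lemma laplacian_eq_divergence_grad (hf : ContDiffAt ℝ 2 f y) :
    laplacian G f y = divergence G (grad G f) y :=
  Finset.sum_congr rfl fun i _ ↦ (hG.covDeriv_grad hy hf i i).symm

lemma partialDeriv_gradInner (hf : ContDiffAt ℝ 2 f y) (hh : ContDiffAt ℝ 2 h y) (k : Fin n) :
    partialDeriv k (gradInner G f h) y
      = ∑ i, (hessian G f k i y * grad G h i y + hessian G h k i y * grad G f i y) := by
  have deriv_grad (i : Fin n) : partialDeriv k (grad G h i) y
      = ∑ j, (G y)⁻¹ i j * hessian G h k j y - ∑ p, christoffel G i k p y * grad G h p y :=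
    eq_sub_of_add_eq (hG.covDeriv_grad hy hh k i)
  have hessian_part : ∑ i, partialDeriv i f y * ∑ j, (G y)⁻¹ i j * hessian G h k j y
      = ∑ i, hessian G h k i y * grad G f i y := by
    simp only [grad, Finset.mul_sum]
    rw [Finset.sum_comm]
    exact Finset.sum_congr rfl fun i _ ↦ Finset.sum_congr rfl fun j _ ↦ by
      rw [hG.inv_symm hy i j]; ring
  have connection_part : ∑ i, partialDeriv i f y * ∑ p, christoffel G i k p y * grad G h p y
      = ∑ i, (∑ p, christoffel G p k i y * partialDeriv p f y) * grad G h i y := by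
    simp only [Finset.mul_sum, Finset.sum_mul]
    rw [Finset.sum_comm]
    exact Finset.sum_congr rfl fun i _ ↦ Finset.sum_congr rfl fun j _ ↦ by ring
  have product_rule : partialDeriv k (gradInner G f h) y
      = ∑ i, (partialDeriv k (partialDeriv i f) y * grad G h i y
        + partialDeriv i f y * partialDeriv k (grad G h i) y) :=
    partialDeriv_sum_mul _ k (fun i _ ↦ differentiableAt_partialDeriv hf i)
      fun i _ ↦ hG.differentiableAt_grad hy hh i
  rw [product_rule]
  simp only [deriv_grad, mul_sub, Finset.sum_add_distrib, Finset.sum_sub_distrib, hessian_part,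
    connection_part]
  rw [add_sub_left_comm, add_comm]
  rw [← Finset.sum_sub_distrib]
  simp only [← sub_mul]
  rfl

lemma grad_gradInner_self (hf : ContDiffAt ℝ 2 f y) (k : Fin n) :
    grad G (gradInner G f f) k y
      = 2 * ∑ i, grad G f i y * covDeriv G (grad G f) i k y := by
  have expand : grad G (gradInner G f f) k y
      = ∑ j, (G y)⁻¹ k j * partialDeriv j (gradInner G f f) y := rfl
  simp only [expand, hG.covDeriv_grad hy hf,
    hG.partialDeriv_gradInner hy hf hf, ← two_mul, ← Finset.mul_sum, mul_left_comm _ (2 : ℝ)]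
  simp only [Finset.mul_sum]
  rw [Finset.sum_comm]
  exact Finset.sum_congr rfl fun i _ ↦ Finset.sum_congr rfl fun j _ ↦ by
    rw [hG.hessian_symm hy hf]; ring

lemma bochner_formula (hf : ContDiffAt ℝ 3 f y) :
    laplacian G (gradInner G f f) y / 2 - gradInner G f (laplacian G f) y
      = ∑ k, ∑ i, covDeriv G (grad G f) k i y * covDeriv G (grad G f) i k y
        + ∑ i, ∑ j, ricci G i j y * grad G f i y * grad G f j y := by
  have hgrad (k : Fin n) : ContDiffAt ℝ 2 (grad G f k) y :=
    hG.contDiffAt_grad hy hf (by norm_num) ENat.LEInfty.out k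
  have near_y : ∀ᶠ z in 𝓝 y, z ∈ U ∧ ContDiffAt ℝ 2 f z := by
    have hf₂ : ContDiffAt ℝ 2 f y := hf.of_le (by norm_num)
    filter_upwards [hG.mem_nhds hy, hf₂.eventually (by simp)] with z h₁ h₂
      using ⟨h₁, h₂⟩
  have laplacian_normSq : laplacian G (gradInner G f f) y
      = 2 * divergence G (fun k z ↦ ∑ i, grad G f i z * covDeriv G (grad G f) i k z) y := by
    rw [hG.laplacian_eq_divergence_grad hy
        (hG.contDiffAt_gradInner hy hf hf (by norm_num) ENat.LEInfty.out),
      divergence_congr fun k ↦ near_y.mono fun z hz ↦ hG.grad_gradInner_self hz.1 hz.2 k,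
      divergence_const_mul]
    exact fun k ↦ DifferentiableAt.fun_sum fun i _ ↦
      ((hgrad i).differentiableAt two_ne_zero).fun_mul
        (hG.differentiableAt_covDeriv hy hgrad i k)
  have deriv_laplacian (i : Fin n) : partialDeriv i (laplacian G f) y
      = partialDeriv i (divergence G (grad G f)) y :=
    partialDeriv_congr i (near_y.mono fun z hz ↦ hG.laplacian_eq_divergence_grad hz.1 hz.2)
  rw [laplacian_normSq, hG.divergence_covDeriv_self hy hgrad, hG.gradInner_eq_sum_grad_mul hy]
  simp only [deriv_laplacian]
  ring

lemma sum_metric_mul_grad :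
    ∑ i, ∑ j, G y i j * grad G f i y * grad G f j y = gradInner G f f y := by
  have lower (i : Fin n) : ∑ j, G y i j * grad G f j y = partialDeriv i f y := by
    have : G y *ᵥ ((G y)⁻¹ *ᵥ fun j ↦ partialDeriv j f y) = fun j ↦ partialDeriv j f y := by
      rw [Matrix.mulVec_mulVec, hG.mul_inv hy, Matrix.one_mulVec]
    exact congrFun this i
  refine Finset.sum_congr rfl fun i _ ↦ ?_
  rw [← lower, Finset.sum_mul]
  exact Finset.sum_congr rfl fun j _ ↦ by ring

lemma sq_laplacian_div_le (hf : ContDiffAt ℝ 2 f y) :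
    laplacian G f y ^ 2 / n
      ≤ ∑ k, ∑ i, covDeriv G (grad G f) k i y * covDeriv G (grad G f) i k y := by
  let H : Matrix (Fin n) (Fin n) ℝ := Matrix.of fun i j ↦ hessian G f j i y
  have hH : Hᵀ = H := Matrix.ext fun i j ↦ hG.hessian_symm hy hf i j
  have mul_apply (k i : Fin n) : ((G y)⁻¹ * H) k i = covDeriv G (grad G f) i k y :=
    (hG.covDeriv_grad hy hf i k).symm
  have trace_eq : ((G y)⁻¹ * H).trace = laplacian G f y := rfl
  have trace_sq_eq : ((G y)⁻¹ * H * ((G y)⁻¹ * H)).trace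
      = ∑ k, ∑ i, covDeriv G (grad G f) k i y * covDeriv G (grad G f) i k y := by
    simp only [Matrix.trace, Matrix.diag_apply, Matrix.mul_apply (M := (G y)⁻¹ * H),
      mul_apply]
    exact Finset.sum_congr rfl fun k _ ↦ Finset.sum_congr rfl fun i _ ↦ mul_comm _ _
  have cauchy_schwarz := sq_trace_posSemidef_mul_le (hG.posDef y hy).inv.posSemidef hH
  rw [trace_eq, trace_sq_eq, Fintype.card_fin] at cauchy_schwarz
  obtain rfl | hn := n.eq_zero_or_pos
  · simp
  · rwa [div_le_iff₀' (by exact_mod_cast hn)]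

lemma curvatureDimensionAt {K : ℝ}
    (hK : ∀ v : Fin n → ℝ, K * ∑ i, ∑ j, G y i j * v i * v j
      ≤ ∑ i, ∑ j, ricci G i j y * v i * v j) :
    CurvatureDimensionAt G K y := by
  intro f hf
  rw [hG.bochner_formula hy hf, ← hG.sum_metric_mul_grad hy]
  exact add_le_add (hG.sq_laplacian_div_le hy (hf.of_le (by norm_num))) (hK _)

end IsMetricOn

/-! ### Changes of coordinates -/

/-- The Jacobian matrix `(∂_i τ^a)_ai` of a change of coordinates. -/
def jacobian (τ : Euc n → Euc n) (y : Euc n) : Matrix (Fin n) (Fin n) ℝ :=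
  Matrix.of fun a i ↦ partialDeriv i (fun z ↦ τ z a) y

section Jacobian

variable {τ : Euc n → Euc n} {y : Euc n} {f : Euc n → ℝ}

lemma contDiffAt_apply {k : WithTop ℕ∞} (hτ : ContDiffAt ℝ k τ y) (a : Fin n) :
    ContDiffAt ℝ k (fun z ↦ τ z a) y :=
  (EuclideanSpace.proj a : Euc n →L[ℝ] ℝ).contDiff.contDiffAt.comp y hτ

lemma differentiableAt_jacobian (hτ : ContDiffAt ℝ 2 τ y) (a i : Fin n) :
    DifferentiableAt ℝ (fun z ↦ jacobian τ z a i) y :=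
  differentiableAt_partialDeriv (contDiffAt_apply hτ a) i

lemma partialDeriv_jacobian_comm (hτ : ContDiffAt ℝ 2 τ y) (a i j : Fin n) :
    partialDeriv i (fun z ↦ jacobian τ z a j) y = partialDeriv j (fun z ↦ jacobian τ z a i) y :=
  partialDeriv_comm (contDiffAt_apply hτ a) i j

lemma fderiv_apply_eq_jacobian (hτ : DifferentiableAt ℝ τ y) (v : Euc n) (a : Fin n) :
    fderiv ℝ τ y v a = ∑ i, jacobian τ y a i * v i := by
  have fderiv_proj : fderiv ℝ (fun z ↦ τ z a) y v = fderiv ℝ τ y v a :=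
    congrArg (fun L : Euc n →L[ℝ] ℝ ↦ L v)
      ((EuclideanSpace.proj a : Euc n →L[ℝ] ℝ).hasFDerivAt.comp y hτ.hasFDerivAt).fderiv
  rw [← fderiv_proj, fderiv_apply_eq_sum]
  rfl

lemma det_fderiv_eq_det_jacobian (hτ : DifferentiableAt ℝ τ y) :
    (fderiv ℝ τ y).det = (jacobian τ y).det := by
  have toMatrix_eq : LinearMap.toMatrix (EuclideanSpace.basisFun (Fin n) ℝ).toBasis
      (EuclideanSpace.basisFun (Fin n) ℝ).toBasis (fderiv ℝ τ y : Euc n →ₗ[ℝ] Euc n)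
      = jacobian τ y := by
    ext a i
    simp [LinearMap.toMatrix_apply, fderiv_apply_eq_jacobian hτ]
  rw [← toMatrix_eq, LinearMap.det_toMatrix]

lemma partialDeriv_comp_map (hτ : DifferentiableAt ℝ τ y) (hf : DifferentiableAt ℝ f (τ y))
    (i : Fin n) : partialDeriv i (fun z ↦ f (τ z)) y
      = ∑ b, partialDeriv b f (τ y) * jacobian τ y b i := by
  change fderiv ℝ (f ∘ τ) y _ = _
  rw [fderiv_comp y hf hτ, ContinuousLinearMap.comp_apply, fderiv_apply_eq_sum]
  simp only [fderiv_apply_eq_jacobian hτ, PiLp.single_apply, mul_ite, mul_one, mul_zero,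
    Finset.sum_ite_eq', Finset.mem_univ, if_true]

end Jacobian

lemma mul_inv_transpose_mul_mul {ι : Type*} [Fintype ι] [DecidableEq ι] {J : Matrix ι ι ℝ}
    (hJ : IsUnit J.det) (A : Matrix ι ι ℝ) : J * (Jᵀ * A * J)⁻¹ * Jᵀ = A⁻¹ := by
  have hJt : IsUnit Jᵀ.det := by rwa [Matrix.det_transpose]
  rw [Matrix.mul_inv_rev, Matrix.mul_inv_rev, ← Matrix.mul_assoc, Matrix.mul_nonsing_inv _ hJ,
    Matrix.one_mul, Matrix.mul_assoc, Matrix.nonsing_inv_mul _ hJt, Matrix.mul_one]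

section ChainRule

variable {G : Euc n → Matrix (Fin n) (Fin n) ℝ} {y : Euc n} {f h : Euc n → ℝ}

lemma laplacian_congr (e : f =ᶠ[𝓝 y] h) : laplacian G f y = laplacian G h y := by
  simp only [laplacian, hessian, partialDeriv_congr _ e,
    partialDeriv_congr _ (partialDeriv_eventuallyEq _ e)]

lemma gradInner_congr {f' h' : Euc n → ℝ} (ef : f =ᶠ[𝓝 y] f') (eh : h =ᶠ[𝓝 y] h') :
    gradInner G f h y = gradInner G f' h' y := by
  simp only [gradInner, grad, partialDeriv_congr _ ef, partialDeriv_congr _ eh]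

lemma hessian_sum {ι : Type*} (s : Finset ι) {F : ι → Euc n → ℝ}
    (hF : ∀ a ∈ s, ContDiffAt ℝ 2 (F a) y) (i j : Fin n) :
    hessian G (fun z ↦ ∑ a ∈ s, F a z) i j y = ∑ a ∈ s, hessian G (F a) i j y := by
  have differentiable_near : ∀ᶠ z in 𝓝 y, ∀ a ∈ s, DifferentiableAt ℝ (F a) z := by
    rw [Finset.eventually_all]
    exact fun a ha ↦ ((hF a ha).eventually (by simp)).mono fun z hz ↦
      hz.differentiableAt two_ne_zero
  simp only [hessian]
  rw [partialDeriv_congr i (differentiable_near.mono fun z hz ↦ partialDeriv_sum s j hz),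
    partialDeriv_sum s i fun a ha ↦ differentiableAt_partialDeriv (hF a ha) j]
  simp only [partialDeriv_sum s _ differentiable_near.self_of_nhds, Finset.sum_sub_distrib,
    Finset.mul_sum]
  rw [Finset.sum_comm]

lemma laplacian_sum {ι : Type*} (s : Finset ι) {F : ι → Euc n → ℝ}
    (hF : ∀ a ∈ s, ContDiffAt ℝ 2 (F a) y) :
    laplacian G (fun z ↦ ∑ a ∈ s, F a z) y = ∑ a ∈ s, laplacian G (F a) y := by
  simp only [laplacian, hessian_sum s hF, Finset.mul_sum]
  rw [Finset.sum_comm_cycle]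

lemma gradInner_sum_right {ι : Type*} (s : Finset ι) {F : ι → Euc n → ℝ}
    (hF : ∀ a ∈ s, DifferentiableAt ℝ (F a) y) :
    gradInner G f (fun z ↦ ∑ a ∈ s, F a z) y = ∑ a ∈ s, gradInner G f (F a) y := by
  simp only [gradInner, grad, partialDeriv_sum s _ hF, Finset.mul_sum]
  rw [Finset.sum_comm_cycle]

variable {H H' : ℝ → ℝ} {H'' : ℝ}

lemma hessian_comp_real (hH : ∀ t, HasDerivAt H (H' t) t) (hH' : HasDerivAt H' H'' (f y))
    (hf : ContDiffAt ℝ 2 f y) (i j : Fin n) :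
    hessian G (fun z ↦ H (f z)) i j y
      = H' (f y) * hessian G f i j y + H'' * (partialDeriv i f y * partialDeriv j f y) := by
  have differentiable_near : ∀ᶠ z in 𝓝 y, DifferentiableAt ℝ f z :=
    (hf.eventually (by simp)).mono fun z hz ↦ hz.differentiableAt two_ne_zero
  have hf1 : DifferentiableAt ℝ f y := differentiable_near.self_of_nhds
  have hH'f : DifferentiableAt ℝ (fun z ↦ H' (f z)) y := hH'.differentiableAt.comp y hf1
  simp only [hessian]
  rw [partialDeriv_congr i (differentiable_near.mono fun z hz ↦ partialDeriv_comp_real j (hH _) hz),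
    partialDeriv_mul i hH'f (differentiableAt_partialDeriv hf j),
    partialDeriv_comp_real i hH' hf1]
  simp only [partialDeriv_comp_real _ (hH _) hf1, mul_sub, Finset.mul_sum]
  simp only [mul_left_comm (christoffel G _ _ _ _)]
  ring

lemma laplacian_comp_real (hH : ∀ t, HasDerivAt H (H' t) t) (hH' : HasDerivAt H' H'' (f y))
    (hf : ContDiffAt ℝ 2 f y) :
    laplacian G (fun z ↦ H (f z)) y = H' (f y) * laplacian G f y + H'' * gradInner G f f y := by
  simp only [laplacian, hessian_comp_real hH hH' hf, gradInner, grad, mul_add,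
    Finset.sum_add_distrib, Finset.mul_sum]
  congr 1
  · simp only [mul_left_comm ((G y)⁻¹ _ _)]
  · exact Finset.sum_congr rfl fun i _ ↦ Finset.sum_congr rfl fun j _ ↦ by ring

end ChainRule

namespace IsMetricOn

section Invariance

variable {G G' : Euc n → Matrix (Fin n) (Fin n) ℝ} {U U' : Set (Euc n)} {τ : Euc n → Euc n}
  {y : Euc n} {f h : Euc n → ℝ}

lemma isUnit_det_jacobian (hG : IsMetricOn G U) (hy : y ∈ U)
    (hGG' : G y = (jacobian τ y)ᵀ * G' (τ y) * jacobian τ y) : IsUnit (jacobian τ y).det := by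
  have hdet := hG.det_pos hy
  rw [hGG', Matrix.det_mul] at hdet
  exact (right_ne_zero_of_mul hdet.ne').isUnit

lemma derivMatrix_pullback (hG' : IsMetricOn G' U') (hτy : τ y ∈ U') (hτ : ContDiffAt ℝ 2 τ y)
    (hGG' : ∀ᶠ z in 𝓝 y, G z = (jacobian τ z)ᵀ * G' (τ z) * jacobian τ z) (i j l : Fin n) :
    derivMatrix G i y j l
      = ∑ b, ∑ c, partialDeriv i (fun z ↦ jacobian τ z b j) y * G' (τ y) b c * jacobian τ y c l
        + ∑ b, ∑ c, partialDeriv i (fun z ↦ jacobian τ z b l) y * G' (τ y) b c * jacobian τ y c j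
        + ∑ b, ∑ c, ∑ d, jacobian τ y d i * jacobian τ y b j * jacobian τ y c l
          * derivMatrix G' d (τ y) b c := by
  have dτ : DifferentiableAt ℝ τ y := hτ.differentiableAt two_ne_zero
  have dJ := differentiableAt_jacobian hτ
  have dG' (b c : Fin n) : DifferentiableAt ℝ (fun z ↦ G' (τ z) b c) y :=
    (hG'.differentiableAt hτy b c).comp y dτ
  have expand : (fun z ↦ G z j l) =ᶠ[𝓝 y] fun z ↦ ∑ b, jacobian τ z b j *
      ∑ c, G' (τ z) b c * jacobian τ z c l := by
    filter_upwards [hGG'] with z hz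
    rw [hz, Matrix.mul_assoc]
    simp only [Matrix.mul_apply, Matrix.transpose_apply]
  have swap : ∑ b, ∑ c, partialDeriv i (fun z ↦ jacobian τ z b l) y * G' (τ y) b c
      * jacobian τ y c j
      = ∑ b, ∑ c, jacobian τ y b j * G' (τ y) b c
        * partialDeriv i (fun z ↦ jacobian τ z c l) y := by
    rw [Finset.sum_comm]
    refine Finset.sum_congr rfl fun b _ ↦ Finset.sum_congr rfl fun c _ ↦ ?_
    rw [hG'.symm hτy b c]
    ring
  have product_rule (b : Fin n) :
      partialDeriv i (fun z ↦ ∑ c, G' (τ z) b c * jacobian τ z c l) y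
        = ∑ c, ((∑ d, derivMatrix G' d (τ y) b c * jacobian τ y d i) * jacobian τ y c l
          + G' (τ y) b c * partialDeriv i (fun z ↦ jacobian τ z c l) y) := by
    rw [partialDeriv_sum_mul _ i (fun c _ ↦ dG' b c) fun c _ ↦ dJ c l]
    simp only [partialDeriv_comp_map (f := fun w ↦ G' w b _) dτ (hG'.differentiableAt hτy b _)]
    rfl
  calc derivMatrix G i y j l
      = partialDeriv i (fun z ↦ ∑ b, jacobian τ z b j * ∑ c, G' (τ z) b c * jacobian τ z c l) y :=
        partialDeriv_congr i expand
    _ = _ := by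
        rw [partialDeriv_sum_mul _ i (fun b _ ↦ dJ b j) fun b _ ↦
          DifferentiableAt.fun_sum fun c _ ↦ (dG' b c).fun_mul (dJ c l), swap]
        simp only [product_rule, ← Finset.sum_add_distrib, Finset.mul_sum, Finset.sum_mul, mul_add]
        refine Finset.sum_congr rfl fun b _ ↦ Finset.sum_congr rfl fun c _ ↦ ?_
        rw [add_assoc, ← mul_assoc, ← mul_assoc, add_comm (∑ d, _) (_ * _)]
        congr 2
        exact Finset.sum_congr rfl fun d _ ↦ by ring

lemma christoffelFirst_pullback (hG' : IsMetricOn G' U') (hτy : τ y ∈ U')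
    (hτ : ContDiffAt ℝ 2 τ y)
    (hGG' : ∀ᶠ z in 𝓝 y, G z = (jacobian τ z)ᵀ * G' (τ z) * jacobian τ z) (l i j : Fin n) :
    christoffelFirst G l i j y
      = ∑ a, ∑ b, ∑ c, jacobian τ y a l * jacobian τ y b i * jacobian τ y c j
          * christoffelFirst G' a b c (τ y)
        + ∑ b, ∑ c, partialDeriv i (fun z ↦ jacobian τ z b j) y * G' (τ y) b c
          * jacobian τ y c l := by
  simp only [christoffelFirst, hG'.derivMatrix_pullback hτy hτ hGG']
  set J := jacobian τ y
  let T : Fin n → Fin n → Fin n → ℝ := fun i j l ↦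
    ∑ b, ∑ c, ∑ d, J d i * J b j * J c l * derivMatrix G' d (τ y) b c
  have T_ijl : T i j l = ∑ a, ∑ b, ∑ c, J b i * J c j * J a l * derivMatrix G' b (τ y) c a := by
    simp only [T]
    rw [Finset.sum_comm_cycle, Finset.sum_comm_cycle]
  have T_jil : T j i l = ∑ a, ∑ b, ∑ c, J c j * J b i * J a l * derivMatrix G' c (τ y) b a :=
    Finset.sum_comm
  have T_lij : T l i j = ∑ a, ∑ b, ∑ c, J a l * J b i * J c j * derivMatrix G' a (τ y) b c :=
    Finset.sum_comm_cycle
  have first_kind : ∑ a, ∑ b, ∑ c, J a l * J b i * J c j * (1 / 2 * (derivMatrix G' b (τ y) c a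
        + derivMatrix G' c (τ y) b a - derivMatrix G' a (τ y) b c))
      = 1 / 2 * (T i j l + T j i l - T l i j) := by
    rw [T_ijl, T_jil, T_lij]
    simp only [← Finset.sum_add_distrib, ← Finset.sum_sub_distrib, Finset.mul_sum]
    exact Finset.sum_congr rfl fun a _ ↦ Finset.sum_congr rfl fun b _ ↦
      Finset.sum_congr rfl fun c _ ↦ by ring
  rw [first_kind]
  simp only [partialDeriv_jacobian_comm hτ _ j i, partialDeriv_jacobian_comm hτ _ l i,
    partialDeriv_jacobian_comm hτ _ l j]
  ring

lemma sum_jacobian_mul_christoffel (hG : IsMetricOn G U) (hy : y ∈ U) (hG' : IsMetricOn G' U')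
    (hτy : τ y ∈ U') (hτ : ContDiffAt ℝ 2 τ y)
    (hGG' : ∀ᶠ z in 𝓝 y, G z = (jacobian τ z)ᵀ * G' (τ z) * jacobian τ z) (a i j : Fin n) :
    ∑ k, jacobian τ y a k * christoffel G k i j y
      = ∑ b, ∑ c, christoffel G' a b c (τ y) * jacobian τ y b i * jacobian τ y c j
        + partialDeriv i (fun z ↦ jacobian τ z a j) y := by
  set J := jacobian τ y with hJ
  have hP : IsUnit (Jᵀ * G' (τ y)) := by
    rw [Matrix.isUnit_iff_isUnit_det, Matrix.det_mul, Matrix.det_transpose]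
    exact (hG.isUnit_det_jacobian hy hGG'.self_of_nhds).mul (hG'.det_pos hτy).ne'.isUnit
  let L : Fin n → ℝ := fun a ↦ ∑ k, J a k * christoffel G k i j y
  let R : Fin n → ℝ := fun a ↦ ∑ b, ∑ c, christoffel G' a b c (τ y) * J b i * J c j
    + partialDeriv i (fun z ↦ jacobian τ z a j) y
  suffices hLR : (Jᵀ * G' (τ y)) *ᵥ L = (Jᵀ * G' (τ y)) *ᵥ R from
    congrFun (Matrix.mulVec_injective_iff_isUnit.2 hP hLR) a
  have hL : (Jᵀ * G' (τ y)) *ᵥ L = fun l ↦ christoffelFirst G l i j y := by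
    have hJL : L = J *ᵥ fun k ↦ christoffel G k i j y := rfl
    rw [hJL, Matrix.mulVec_mulVec, hJ, ← hGG'.self_of_nhds]
    exact funext fun l ↦ hG.sum_metric_mul_christoffel hy l i j
  have hR (d : Fin n) : (G' (τ y) *ᵥ R) d
      = ∑ b, ∑ c, J b i * J c j * christoffelFirst G' d b c (τ y)
        + ∑ a, partialDeriv i (fun z ↦ jacobian τ z a j) y * G' (τ y) a d := by
    simp only [Matrix.mulVec, dotProduct, R, mul_add, Finset.sum_add_distrib, Finset.mul_sum,
      ← hG'.sum_metric_mul_christoffel hτy]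
    rw [Finset.sum_comm_cycle, Finset.sum_comm_cycle]
    congr 1
    · exact Finset.sum_congr rfl fun b _ ↦ Finset.sum_congr rfl fun c _ ↦
        Finset.sum_congr rfl fun a _ ↦ by ring
    · exact Finset.sum_congr rfl fun a _ ↦ by rw [hG'.symm hτy d a, mul_comm]
  rw [hL, ← Matrix.mulVec_mulVec]
  ext l
  rw [hG'.christoffelFirst_pullback hτy hτ hGG']
  change _ = ∑ d, J d l * (G' (τ y) *ᵥ R) d
  simp only [hR, mul_add, Finset.sum_add_distrib, Finset.mul_sum]
  congr 1
  · exact Finset.sum_congr rfl fun d _ ↦ Finset.sum_congr rfl fun b _ ↦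
      Finset.sum_congr rfl fun c _ ↦ by ring
  · rw [Finset.sum_comm]
    exact Finset.sum_congr rfl fun d _ ↦ Finset.sum_congr rfl fun a _ ↦ by rw [mul_comm]

lemma hessian_comp (hG : IsMetricOn G U) (hy : y ∈ U) (hG' : IsMetricOn G' U')
    (hτy : τ y ∈ U') (hτ : ContDiffAt ℝ 2 τ y)
    (hGG' : ∀ᶠ z in 𝓝 y, G z = (jacobian τ z)ᵀ * G' (τ z) * jacobian τ z)
    (hf : ContDiffAt ℝ 2 f (τ y)) (i j : Fin n) :
    hessian G (fun z ↦ f (τ z)) i j y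
      = ∑ a, ∑ b, jacobian τ y b i * hessian G' f b a (τ y) * jacobian τ y a j := by
  have dτ : DifferentiableAt ℝ τ y := hτ.differentiableAt two_ne_zero
  have differentiable_near : ∀ᶠ z in 𝓝 y, DifferentiableAt ℝ τ z ∧ DifferentiableAt ℝ f (τ z) := by
    filter_upwards [hτ.eventually (by simp),
      dτ.continuousAt.eventually (hf.eventually (by simp))] with z hτz hfz
      using ⟨hτz.differentiableAt two_ne_zero, hfz.differentiableAt two_ne_zero⟩
  have df : DifferentiableAt ℝ f (τ y) := differentiable_near.self_of_nhds.2
  have d2f := differentiableAt_partialDeriv hf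
  have d2fτ (a : Fin n) : DifferentiableAt ℝ (fun z ↦ partialDeriv a f (τ z)) y :=
    (d2f a).comp y dτ
  have second_deriv : partialDeriv i (partialDeriv j fun z ↦ f (τ z)) y
      = ∑ a, ((∑ b, partialDeriv b (partialDeriv a f) (τ y) * jacobian τ y b i) * jacobian τ y a j
        + partialDeriv a f (τ y) * partialDeriv i (fun z ↦ jacobian τ z a j) y) := by
    rw [partialDeriv_congr i
        (differentiable_near.mono fun z hz ↦ partialDeriv_comp_map hz.1 hz.2 j),
      partialDeriv_sum_mul _ i (fun a _ ↦ d2fτ a) fun a _ ↦ differentiableAt_jacobian hτ a j]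
    simp only [partialDeriv_comp_map dτ (d2f _)]
  have first_deriv : ∑ k, christoffel G k i j y * partialDeriv k (fun z ↦ f (τ z)) y
      = ∑ a, partialDeriv a f (τ y) * ∑ k, jacobian τ y a k * christoffel G k i j y := by
    simp only [partialDeriv_comp_map dτ df, Finset.mul_sum]
    rw [Finset.sum_comm]
    exact Finset.sum_congr rfl fun a _ ↦ Finset.sum_congr rfl fun k _ ↦ by ring
  simp only [hessian]
  rw [second_deriv, first_deriv]
  simp only [hG.sum_jacobian_mul_christoffel hy hG' hτy hτ hGG', mul_add, mul_sub, sub_mul,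
    Finset.sum_add_distrib, Finset.sum_sub_distrib, Finset.mul_sum, Finset.sum_mul]
  rw [add_sub_add_right_eq_sub]
  congr 1
  · exact Finset.sum_congr rfl fun a _ ↦ Finset.sum_congr rfl fun b _ ↦ by ring
  · rw [Finset.sum_comm_cycle, Finset.sum_comm_cycle, Finset.sum_comm]
    exact Finset.sum_congr rfl fun a _ ↦ Finset.sum_congr rfl fun b _ ↦
      Finset.sum_congr rfl fun c _ ↦ by ring

lemma laplacian_comp (hG : IsMetricOn G U) (hy : y ∈ U) (hG' : IsMetricOn G' U')
    (hτy : τ y ∈ U') (hτ : ContDiffAt ℝ 2 τ y)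
    (hGG' : ∀ᶠ z in 𝓝 y, G z = (jacobian τ z)ᵀ * G' (τ z) * jacobian τ z)
    (hf : ContDiffAt ℝ 2 f (τ y)) :
    laplacian G (fun z ↦ f (τ z)) y = laplacian G' f (τ y) := by
  have hJ := hG.isUnit_det_jacobian hy hGG'.self_of_nhds
  set J := jacobian τ y with hJdef
  let H : Matrix (Fin n) (Fin n) ℝ := Matrix.of fun i j ↦ hessian G' f i j (τ y)
  have sum_mul_eq_trace (A B : Matrix (Fin n) (Fin n) ℝ) :
      ∑ i, ∑ j, A i j * B i j = (A * Bᵀ).trace := by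
    simp only [Matrix.trace, Matrix.diag_apply, Matrix.mul_apply, Matrix.transpose_apply]
  have hessian_eq (i j : Fin n) : hessian G (fun z ↦ f (τ z)) i j y = (Jᵀ * H * J) i j := by
    rw [hG.hessian_comp hy hG' hτy hτ hGG' hf]
    simp only [Matrix.mul_apply, Matrix.transpose_apply, Finset.sum_mul]
    rfl
  calc laplacian G (fun z ↦ f (τ z)) y = ((G y)⁻¹ * (Jᵀ * H * J)ᵀ).trace := by
        simp only [laplacian, hessian_eq, sum_mul_eq_trace]
    _ = (J * (Jᵀ * G' (τ y) * J)⁻¹ * Jᵀ * Hᵀ).trace := by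
        rw [hGG'.self_of_nhds, ← hJdef, Matrix.transpose_mul, Matrix.transpose_mul,
          Matrix.transpose_transpose, ← Matrix.mul_assoc, ← Matrix.mul_assoc, Matrix.trace_mul_comm]
        simp only [Matrix.mul_assoc]
    _ = laplacian G' f (τ y) := by
        rw [mul_inv_transpose_mul_mul hJ, ← sum_mul_eq_trace]
        rfl

lemma gradInner_comp (hG : IsMetricOn G U) (hy : y ∈ U) (hτ : DifferentiableAt ℝ τ y)
    (hGG' : G y = (jacobian τ y)ᵀ * G' (τ y) * jacobian τ y)
    (hf : DifferentiableAt ℝ f (τ y)) (hh : DifferentiableAt ℝ h (τ y)) :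
    gradInner G (fun z ↦ f (τ z)) (fun z ↦ h (τ z)) y = gradInner G' f h (τ y) := by
  have hJ := hG.isUnit_det_jacobian hy hGG'
  set J := jacobian τ y
  have gradInner_eq (A : Euc n → Matrix (Fin n) (Fin n) ℝ) (f h : Euc n → ℝ) (z : Euc n) :
      gradInner A f h z
        = (fun i ↦ partialDeriv i f z) ⬝ᵥ ((A z)⁻¹ *ᵥ fun j ↦ partialDeriv j h z) := rfl
  have differential_comp {f : Euc n → ℝ} (hf : DifferentiableAt ℝ f (τ y)) :
      (fun i ↦ partialDeriv i (fun z ↦ f (τ z)) y) = Jᵀ *ᵥ fun a ↦ partialDeriv a f (τ y) := by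
    ext i
    simp only [partialDeriv_comp_map hτ hf, Matrix.mulVec, dotProduct, Matrix.transpose_apply,
      mul_comm, J]
  rw [gradInner_eq, gradInner_eq, differential_comp hf, differential_comp hh, hGG',
    Matrix.mulVec_mulVec, Matrix.mulVec_transpose, ← Matrix.dotProduct_mulVec,
    Matrix.mulVec_mulVec, ← Matrix.mul_assoc, mul_inv_transpose_mul_mul hJ]

lemma curvatureDimensionAt_comp {K : ℝ} (hG : IsMetricOn G U) (hy : y ∈ U)
    (hG' : IsMetricOn G' U') (hτy : τ y ∈ U') (hτ : ContDiffAt ℝ 3 τ y)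
    (hGG' : ∀ᶠ z in 𝓝 y, G z = (jacobian τ z)ᵀ * G' (τ z) * jacobian τ z)
    (hCD : CurvatureDimensionAt G K y) : CurvatureDimensionAt G' K (τ y) := by
  intro f hf
  have hf2 : ContDiffAt ℝ 2 f (τ y) := hf.of_le (by norm_num)
  have hτ2 : ContDiffAt ℝ 2 τ y := hτ.of_le (by norm_num)
  have regular_near : ∀ᶠ z in 𝓝 y, z ∈ U ∧ τ z ∈ U' ∧ ContDiffAt ℝ 2 τ z ∧ ContDiffAt ℝ 2 f (τ z) ∧
      ∀ᶠ z' in 𝓝 z, G z' = (jacobian τ z')ᵀ * G' (τ z') * jacobian τ z' := by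
    filter_upwards [hG.mem_nhds hy, hτ.continuousAt (hG'.mem_nhds hτy), hτ2.eventually (by simp),
      hτ.continuousAt.eventually (hf2.eventually (by simp)), hGG'.eventually_nhds]
      with z hz hτz hτ2z hfz hGG'z using ⟨hz, hτz, hτ2z, hfz, hGG'z⟩
  have gradInner_near : gradInner G (fun z ↦ f (τ z)) (fun z ↦ f (τ z)) =ᶠ[𝓝 y]
      fun z ↦ gradInner G' f f (τ z) := regular_near.mono fun z ⟨hz, _, hτz, hfz, hGG'z⟩ ↦
    hG.gradInner_comp hz (hτz.differentiableAt two_ne_zero) hGG'z.self_of_nhds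
      (hfz.differentiableAt two_ne_zero) (hfz.differentiableAt two_ne_zero)
  have laplacian_near : laplacian G (fun z ↦ f (τ z)) =ᶠ[𝓝 y] fun z ↦ laplacian G' f (τ z) :=
    regular_near.mono fun z ⟨hz, hτz, hτ2z, hfz, hGG'z⟩ ↦
      hG.laplacian_comp hz hG' hτz hτ2z hGG'z hfz
  have hΓ : ContDiffAt ℝ 2 (gradInner G' f f) (τ y) :=
    hG'.contDiffAt_gradInner hτy hf hf (by norm_num) ENat.LEInfty.out
  have hΔ : DifferentiableAt ℝ (laplacian G' f) (τ y) :=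
    (hG'.contDiffAt_laplacian (r := 1) hτy hf (by norm_num) (by simp)).differentiableAt one_ne_zero
  have hCDf := hCD (fun z ↦ f (τ z)) (hf.comp y hτ)
  rwa [laplacian_congr gradInner_near, gradInner_congr .rfl laplacian_near,
    gradInner_near.self_of_nhds, laplacian_near.self_of_nhds,
    hG.laplacian_comp hy hG' hτy hτ2 hGG' hΓ,
    hG.gradInner_comp hy (hτ.differentiableAt three_ne_zero) hGG'.self_of_nhds
      (hf.differentiableAt three_ne_zero) hΔ] at hCDf

end Invariance

end IsMetricOn

/-! ### The weighted Bochner inequality -/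

lemma continuous_partialDeriv {f : Euc n → ℝ} (hf : ContDiff ℝ 1 f) (i : Fin n) :
    Continuous (partialDeriv i f) :=
  (hf.continuous_fderiv one_ne_zero).clm_apply continuous_const

lemma integrable_partialDeriv {f : Euc n → ℝ} (hf : ContDiff ℝ 1 f) (hc : HasCompactSupport f)
    (i : Fin n) : Integrable (partialDeriv i f) :=
  (continuous_partialDeriv hf i).integrable_of_hasCompactSupport (hc.fderiv_apply (𝕜 := ℝ) _)

lemma integral_partialDeriv_eq_zero {f : Euc n → ℝ} (hf : ContDiff ℝ 1 f)
    (hc : HasCompactSupport f) (i : Fin n) : ∫ y, partialDeriv i f y = 0 := by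
  have by_parts := integral_mul_fderiv_eq_neg_fderiv_mul_of_integrable (μ := volume) (𝕜 := ℝ)
    (f := fun _ : Euc n ↦ (1 : ℝ)) (g := f) (v := EuclideanSpace.single i 1)
    (by simp) (by simp only [one_mul]; exact integrable_partialDeriv hf hc i)
    (by simpa using hf.continuous.integrable_of_hasCompactSupport hc)
    (fun x _ ↦ differentiableAt_const _) (fun x _ ↦ hf.differentiable one_ne_zero x)
  simpa [partialDeriv] using by_parts

lemma integrableOn_of_continuousOn_of_zero {F : Euc n → ℝ} {U C : Set (Euc n)}
    (hU : IsOpen U) (hC : IsCompact C) (hCU : C ⊆ U) (hF : ContinuousOn F U)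
    (h0 : ∀ y ∉ C, F y = 0) : IntegrableOn F U :=
  ((hF.mono hCU).integrableOn_compact hC).of_forall_sdiff_eq_zero hU.measurableSet
    fun y hy ↦ h0 y hy.2

lemma partialDeriv_eq_zero_of_notMem {f : Euc n → ℝ} {C : Set (Euc n)} (hC : IsClosed C)
    (hf : ∀ y ∉ C, f y = 0) {y : Euc n} (hy : y ∉ C) (i : Fin n) : partialDeriv i f y = 0 := by
  rw [partialDeriv_congr i (h := fun _ ↦ 0), partialDeriv_const]
  filter_upwards [hC.isOpen_compl.mem_nhds hy] with z hz using hf z hz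

lemma grad_eq_zero_of_notMem (G : Euc n → Matrix (Fin n) (Fin n) ℝ) {f : Euc n → ℝ}
    {C : Set (Euc n)} (hC : IsClosed C) (h0 : ∀ y ∉ C, f y = 0) {y : Euc n} (hy : y ∉ C)
    (k : Fin n) : grad G f k y = 0 := by
  simp [grad, partialDeriv_eq_zero_of_notMem hC h0 hy]

lemma gradInner_mul_left (G : Euc n → Matrix (Fin n) (Fin n) ℝ) {f h : Euc n → ℝ} {y : Euc n}
    (hf : DifferentiableAt ℝ f y) (hh : DifferentiableAt ℝ h y) (w : Euc n → ℝ) :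
    gradInner G (fun z ↦ f z * h z) w y = f y * gradInner G h w y + h y * gradInner G f w y := by
  simp only [gradInner, partialDeriv_mul _ hf hh, Finset.mul_sum, ← Finset.sum_add_distrib]
  exact Finset.sum_congr rfl fun i _ ↦ by ring

lemma contDiff_of_contDiffAt_of_zero {f : Euc n → ℝ} {U C : Set (Euc n)} {k : WithTop ℕ∞}
    (hC : IsClosed C) (hCU : C ⊆ U) (hf : ∀ y ∈ U, ContDiffAt ℝ k f y)
    (h0 : ∀ y ∉ C, f y = 0) : ContDiff ℝ k f := by
  refine contDiff_iff_contDiffAt.2 fun y ↦ ?_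
  by_cases hy : y ∈ U
  · exact hf y hy
  · have hf0 : f =ᶠ[𝓝 y] fun _ ↦ 0 := by
      filter_upwards [hC.isOpen_compl.mem_nhds fun h ↦ hy (hCU h)] with z hz using h0 z hz
    exact contDiffAt_const.congr_of_eventuallyEq hf0

/-- The integrand of the weighted Bochner inequality: up to divergences, it is `w` times the
difference of the two sides of the curvature-dimension inequality for `f`, but it only involves
derivatives of `f` of order at most two. -/
def bochnerIntegrand (G : Euc n → Matrix (Fin n) (Fin n) ℝ) (K : ℝ) (w f : Euc n → ℝ)
    (y : Euc n) : ℝ :=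
  gradInner G f f y * laplacian G w y / 2 + laplacian G f y * gradInner G f w y
    + w y * (laplacian G f y ^ 2 - laplacian G f y ^ 2 / n) - K * w y * gradInner G f f y

namespace IsMetricOn

variable {G : Euc n → Matrix (Fin n) (Fin n) ℝ} {U C : Set (Euc n)} (hG : IsMetricOn G U)
  {f h w : Euc n → ℝ} {X : Fin n → Euc n → ℝ}

include hG

lemma divergence_mul_volDensity {y : Euc n} (hy : y ∈ U)
    (hX : ∀ k, DifferentiableAt ℝ (X k) y) :
    divergence G X y * volDensity G y
      = ∑ k, partialDeriv k (fun z ↦ X k z * volDensity G z) y := by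
  have product_rule (k : Fin n) : partialDeriv k (fun z ↦ X k z * volDensity G z) y
      = partialDeriv k (X k) y * volDensity G y
        + X k y * (volDensity G y * ∑ l, christoffel G l l k y) := by
    rw [← hG.partialDeriv_volDensity hy]
    exact partialDeriv_mul k (hX k) ((hG.contDiffAt_volDensity hy).differentiableAt (by simp))
  simp only [product_rule, Finset.sum_add_distrib, divergence, covDeriv, add_mul, Finset.sum_mul,
    Finset.mul_sum]
  congr 1
  rw [Finset.sum_comm]
  exact Finset.sum_congr rfl fun l _ ↦ Finset.sum_congr rfl fun k _ ↦ by ring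

section DivergenceTheorem

variable (hC : IsCompact C) (hCU : C ⊆ U) (hX : ∀ y ∈ U, ∀ k, ContDiffAt ℝ 1 (X k) y)
  (h0 : ∀ k, ∀ y ∉ C, X k y = 0)

include hC hCU hX h0

lemma contDiff_mul_volDensity (k : Fin n) : ContDiff ℝ 1 fun z ↦ X k z * volDensity G z :=
  contDiff_of_contDiffAt_of_zero hC.isClosed hCU
    (fun y hy ↦ (hX y hy k).mul ((hG.contDiffAt_volDensity hy).of_le (by simp)))
    fun y hy ↦ by rw [h0 k y hy, zero_mul]

omit hG hCU hX in
lemma hasCompactSupport_mul_volDensity (k : Fin n) :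
    HasCompactSupport fun z ↦ X k z * volDensity G z :=
  HasCompactSupport.intro hC fun y hy ↦ by rw [h0 k y hy, zero_mul]

lemma integrableOn_divergence : IntegrableOn (fun y ↦ divergence G X y * volDensity G y) U :=
  (integrable_finsetSum Finset.univ fun k _ ↦
    integrable_partialDeriv (hG.contDiff_mul_volDensity hC hCU hX h0 k)
      (hasCompactSupport_mul_volDensity hC h0 k) k).integrableOn.congr_fun
    (fun y hy ↦ (hG.divergence_mul_volDensity hy fun k ↦
      (hX y hy k).differentiableAt one_ne_zero).symm) hG.isOpen.measurableSet

lemma integral_divergence_eq_zero : ∫ y in U, divergence G X y * volDensity G y = 0 := by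
  have hY := hG.contDiff_mul_volDensity hC hCU hX h0
  have hYc := hasCompactSupport_mul_volDensity (G := G) hC h0
  calc ∫ y in U, divergence G X y * volDensity G y
      = ∫ y in U, ∑ k, partialDeriv k (fun z ↦ X k z * volDensity G z) y :=
        setIntegral_congr_fun hG.isOpen.measurableSet fun y hy ↦
          hG.divergence_mul_volDensity hy fun k ↦ (hX y hy k).differentiableAt one_ne_zero
    _ = ∫ y, ∑ k, partialDeriv k (fun z ↦ X k z * volDensity G z) y :=
        setIntegral_eq_integral_of_forall_compl_eq_zero fun y hy ↦ Finset.sum_eq_zero fun k _ ↦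
          partialDeriv_eq_zero_of_notMem hC.isClosed
            (fun z hz ↦ by rw [h0 k z hz, zero_mul]) (fun hyC ↦ hy (hCU hyC)) k
    _ = ∑ k, ∫ y, partialDeriv k (fun z ↦ X k z * volDensity G z) y :=
        integral_finsetSum _ fun k _ ↦ integrable_partialDeriv (hY k) (hYc k) k
    _ = 0 := Finset.sum_eq_zero fun k _ ↦ integral_partialDeriv_eq_zero (hY k) (hYc k) k

end DivergenceTheorem

lemma divergence_mul_grad {y : Euc n} (hy : y ∈ U) (hh : DifferentiableAt ℝ h y)
    (hf : ContDiffAt ℝ 2 f y) :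
    divergence G (fun k z ↦ h z * grad G f k z) y
      = h y * laplacian G f y + gradInner G h f y := by
  rw [hG.laplacian_eq_divergence_grad hy hf]
  simp only [divergence, covDeriv, partialDeriv_mul _ hh (hG.differentiableAt_grad hy hf _),
    Finset.sum_add_distrib, mul_add, gradInner, Finset.mul_sum, mul_left_comm (h y)]
  ring

lemma continuousOn_laplacian (hf : ∀ y ∈ U, ContDiffAt ℝ 2 f y) :
    ContinuousOn (laplacian G f) U := fun y hy ↦
  (hG.contDiffAt_laplacian (r := 0) hy (hf y hy) (by norm_num)
    (by simp)).continuousAt.continuousWithinAt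

lemma continuousOn_gradInner (hf : ∀ y ∈ U, ContDiffAt ℝ 1 f y)
    (hh : ∀ y ∈ U, ContDiffAt ℝ 1 h y) : ContinuousOn (gradInner G f h) U := fun y hy ↦
  (hG.contDiffAt_gradInner (r := 0) hy (hf y hy) (hh y hy) (by norm_num)
    (by simp)).continuousAt.continuousWithinAt

lemma continuousOn_volDensity : ContinuousOn (volDensity G) U := fun _ hy ↦
  (hG.contDiffAt_volDensity hy).continuousAt.continuousWithinAt

lemma bochnerIntegrand_eq_add_divergence (K : ℝ) {y : Euc n} (hy : y ∈ U)
    (hf : ContDiffAt ℝ 3 f y) (hw : ContDiffAt ℝ 2 w y) :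
    bochnerIntegrand G K w f y
      = w y * (laplacian G (gradInner G f f) y / 2 - gradInner G f (laplacian G f) y
          - (laplacian G f y ^ 2 / n + K * gradInner G f f y))
        + divergence G (fun k z ↦ gradInner G f f z * grad G w k z) y / 2
        - divergence G (fun k z ↦ w z * grad G (gradInner G f f) k z) y / 2
        + divergence G (fun k z ↦ (w z * laplacian G f z) * grad G f k z) y := by
  have hΓ : ContDiffAt ℝ 2 (gradInner G f f) y :=
    hG.contDiffAt_gradInner hy hf hf (by norm_num) ENat.LEInfty.out
  have dw : DifferentiableAt ℝ w y := hw.differentiableAt two_ne_zero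
  have dΔ : DifferentiableAt ℝ (laplacian G f) y :=
    (hG.contDiffAt_laplacian (r := 1) hy hf (by norm_num) (by simp)).differentiableAt one_ne_zero
  rw [hG.divergence_mul_grad hy (hΓ.differentiableAt two_ne_zero) hw,
    hG.divergence_mul_grad hy dw hΓ, hG.divergence_mul_grad hy (dw.fun_mul dΔ)
      (hf.of_le (by norm_num)), gradInner_mul_left G dw dΔ,
    hG.gradInner_comm hy (f := gradInner G f f), hG.gradInner_comm hy (f := laplacian G f),
    hG.gradInner_comm hy (f := w) (h := f), bochnerIntegrand]
  ring

lemma integrableOn_mul_volDensity (hC : IsCompact C) (hCU : C ⊆ U) (hf : ContinuousOn f U)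
    (h0 : ∀ y ∉ C, f y = 0) : IntegrableOn (fun y ↦ f y * volDensity G y) U :=
  integrableOn_of_continuousOn_of_zero hG.isOpen hC hCU (hf.mul hG.continuousOn_volDensity)
    fun y hy ↦ by rw [h0 y hy, zero_mul]

section DivergenceMulGrad

variable (hC : IsCompact C) (hCU : C ⊆ U) (hh : ∀ y ∈ U, ContDiffAt ℝ 1 h y)
  (hf : ∀ y ∈ U, ContDiffAt ℝ 2 f y) (h0 : ∀ k, ∀ y ∉ C, h y * grad G f k y = 0)

include hC hCU hh hf h0

lemma integrableOn_divergence_mul_grad :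
    IntegrableOn (fun y ↦ divergence G (fun k z ↦ h z * grad G f k z) y * volDensity G y) U :=
  hG.integrableOn_divergence hC hCU (fun y hy k ↦ (hh y hy).mul
    (hG.contDiffAt_grad hy (hf y hy) (by norm_num) (by simp) k)) h0

lemma integral_divergence_mul_grad_eq_zero :
    ∫ y in U, divergence G (fun k z ↦ h z * grad G f k z) y * volDensity G y = 0 :=
  hG.integral_divergence_eq_zero hC hCU (fun y hy k ↦ (hh y hy).mul
    (hG.contDiffAt_grad hy (hf y hy) (by norm_num) (by simp) k)) h0

end DivergenceMulGrad

lemma continuousOn_curvatureDimension_gap (K : ℝ) (hf : ∀ y ∈ U, ContDiffAt ℝ 3 f y) :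
    ContinuousOn (fun y ↦ laplacian G (gradInner G f f) y / 2 - gradInner G f (laplacian G f) y
      - (laplacian G f y ^ 2 / n + K * gradInner G f f y)) U := by
  have hf1 : ∀ y ∈ U, ContDiffAt ℝ 1 f y := fun y hy ↦ (hf y hy).of_le (by norm_num)
  have continuousOn_laplacian_gradInner := hG.continuousOn_laplacian fun y hy ↦
    hG.contDiffAt_gradInner (r := 2) hy (hf y hy) (hf y hy) (by norm_num) ENat.LEInfty.out
  have continuousOn_gradInner_laplacian := hG.continuousOn_gradInner hf1 fun y hy ↦
    hG.contDiffAt_laplacian hy (hf y hy) (by norm_num) (by simp)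
  have continuousOn_laplacian_f := hG.continuousOn_laplacian fun y hy ↦
    (hf y hy).of_le (by norm_num)
  exact ((continuousOn_laplacian_gradInner.div_const _).sub continuousOn_gradInner_laplacian).sub
    (((continuousOn_laplacian_f.pow 2).div_const _).add
      (continuousOn_const.mul (hG.continuousOn_gradInner hf1 hf1)))

lemma integral_bochnerIntegrand_eq (K : ℝ) (hC : IsCompact C) (hCU : C ⊆ U)
    (hf : ∀ y ∈ U, ContDiffAt ℝ 3 f y) (hw : ∀ y ∈ U, ContDiffAt ℝ 2 w y)
    (h0 : ∀ y ∉ C, w y = 0) :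
    ∫ y in U, bochnerIntegrand G K w f y * volDensity G y
      = ∫ y in U, w y * (laplacian G (gradInner G f f) y / 2 - gradInner G f (laplacian G f) y
          - (laplacian G f y ^ 2 / n + K * gradInner G f f y)) * volDensity G y := by
  have hf2 : ∀ y ∈ U, ContDiffAt ℝ 2 f y := fun y hy ↦ (hf y hy).of_le (by norm_num)
  have hw1 : ∀ y ∈ U, ContDiffAt ℝ 1 w y := fun y hy ↦ (hw y hy).of_le (by norm_num)
  have hΓ : ∀ y ∈ U, ContDiffAt ℝ 2 (gradInner G f f) y := fun y hy ↦
    hG.contDiffAt_gradInner hy (hf y hy) (hf y hy) (by norm_num) ENat.LEInfty.out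
  have hΔ : ∀ y ∈ U, ContDiffAt ℝ 1 (laplacian G f) y := fun y hy ↦
    hG.contDiffAt_laplacian hy (hf y hy) (by norm_num) (by simp)
  have hwΔ : ∀ y ∈ U, ContDiffAt ℝ 1 (fun z ↦ w z * laplacian G f z) y := fun y hy ↦
    (hw1 y hy).mul (hΔ y hy)
  have hΓ1 : ∀ y ∈ U, ContDiffAt ℝ 1 (gradInner G f f) y := fun y hy ↦
    (hΓ y hy).of_le (by norm_num)
  have zero₁ (k : Fin n) : ∀ y ∉ C, gradInner G f f y * grad G w k y = 0 := fun y hy ↦ by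
    rw [grad_eq_zero_of_notMem G hC.isClosed h0 hy, mul_zero]
  have zero₂ (k : Fin n) : ∀ y ∉ C, w y * grad G (gradInner G f f) k y = 0 := fun y hy ↦ by
    rw [h0 y hy, zero_mul]
  have zero₃ (k : Fin n) : ∀ y ∉ C, w y * laplacian G f y * grad G f k y = 0 := fun y hy ↦ by
    rw [h0 y hy, zero_mul, zero_mul]
  have int₁ := (hG.integrableOn_divergence_mul_grad hC hCU hΓ1 hw zero₁).div_const 2
  have int₂ := (hG.integrableOn_divergence_mul_grad hC hCU hw1 hΓ zero₂).div_const 2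
  have int₃ := hG.integrableOn_divergence_mul_grad hC hCU hwΔ hf2 zero₃
  let gap : Euc n → ℝ := fun y ↦ w y * (laplacian G (gradInner G f f) y / 2
    - gradInner G f (laplacian G f) y - (laplacian G f y ^ 2 / n + K * gradInner G f f y))
  have int_gap := hG.integrableOn_mul_volDensity (f := gap) hC hCU
    ((show ContinuousOn w U from fun y hy ↦ (hw y hy).continuousAt.continuousWithinAt).mul
      (hG.continuousOn_curvatureDimension_gap K hf))
    fun y hy ↦ by simp only [gap, h0 y hy, zero_mul]
  calc ∫ y in U, bochnerIntegrand G K w f y * volDensity G y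
      = ∫ y in U, (gap y * volDensity G y
          + divergence G (fun k z ↦ gradInner G f f z * grad G w k z) y * volDensity G y / 2
          - divergence G (fun k z ↦ w z * grad G (gradInner G f f) k z) y * volDensity G y / 2
          + divergence G (fun k z ↦ (w z * laplacian G f z) * grad G f k z) y
              * volDensity G y) :=
        setIntegral_congr_fun hG.isOpen.measurableSet fun y hy ↦ by
          simp only [hG.bochnerIntegrand_eq_add_divergence K hy (hf y hy) (hw y hy), gap]
          ring
    _ = ∫ y in U, gap y * volDensity G y := by
        rw [integral_add ((int_gap.fun_add int₁).fun_sub int₂) int₃,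
          integral_sub (int_gap.fun_add int₁) int₂, integral_add int_gap int₁, integral_div,
          integral_div, hG.integral_divergence_mul_grad_eq_zero hC hCU hΓ1 hw zero₁,
          hG.integral_divergence_mul_grad_eq_zero hC hCU hw1 hΓ zero₂,
          hG.integral_divergence_mul_grad_eq_zero hC hCU hwΔ hf2 zero₃]
        ring

lemma integral_bochnerIntegrand_nonneg_of_contDiff {K : ℝ} (hC : IsCompact C) (hCU : C ⊆ U)
    (hCD : ∀ y ∈ U, CurvatureDimensionAt G K y) (hf : ∀ y ∈ U, ContDiffAt ℝ 3 f y)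
    (hw : ∀ y ∈ U, ContDiffAt ℝ 2 w y) (hw0 : ∀ y ∈ U, 0 ≤ w y) (h0 : ∀ y ∉ C, w y = 0) :
    0 ≤ ∫ y in U, bochnerIntegrand G K w f y * volDensity G y := by
  rw [hG.integral_bochnerIntegrand_eq K hC hCU hf hw h0]
  exact setIntegral_nonneg hG.isOpen.measurableSet fun y hy ↦
    mul_nonneg (mul_nonneg (hw0 y hy) (sub_nonneg.2 (hCD y hy f (hf y hy))))
      (hG.volDensity_pos hy).le

end IsMetricOn

/-! ### Approximation of `C²` functions -/

/-- A sequence of smooth bump functions with supports shrinking to the origin. -/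
def shrinkingBump (n k : ℕ) : ContDiffBump (0 : Euc n) where
  rIn := 1 / (2 * ((k : ℝ) + 1))
  rOut := 1 / ((k : ℝ) + 1)
  rIn_pos := by positivity
  rIn_lt_rOut := one_div_lt_one_div_of_lt (by positivity) (by linarith [k.cast_nonneg (α := ℝ)])

lemma tendsto_shrinkingBump_rOut :
    Tendsto (fun k ↦ (shrinkingBump n k).rOut) atTop (𝓝 0) :=
  tendsto_one_div_add_atTop_nhds_zero_nat

/-- The mollification of `f`: its convolution with the normalized bump `shrinkingBump n k`. -/
def mollify (k : ℕ) (f : Euc n → ℝ) : Euc n → ℝ :=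
  convolution ((shrinkingBump n k).normed volume) f (ContinuousLinearMap.lsmul ℝ ℝ) volume

lemma contDiff_mollify {f : Euc n → ℝ} (hf : Continuous f) (k : ℕ) :
    ContDiff ℝ ∞ (mollify k f) :=
  (shrinkingBump n k).hasCompactSupport_normed.contDiff_convolution_left _
    (shrinkingBump n k).contDiff_normed hf.locallyIntegrable

lemma tendsto_mollify {f : Euc n → ℝ} (hf : Continuous f) (y : Euc n) :
    Tendsto (fun k ↦ mollify k f y) atTop (𝓝 (f y)) :=
  ContDiffBump.convolution_tendsto_right_of_continuous tendsto_shrinkingBump_rOut hf y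

lemma partialDeriv_mollify {f : Euc n → ℝ} (hf : ContDiff ℝ 1 f) (hc : HasCompactSupport f)
    (i : Fin n) (k : ℕ) : partialDeriv i (mollify k f) = mollify k (partialDeriv i f) := by
  have hl : LocallyIntegrable ((shrinkingBump n k).normed volume) (volume : Measure (Euc n)) :=
    (shrinkingBump n k).continuous_normed.locallyIntegrable
  ext y
  rw [partialDeriv, mollify, mollify, (hc.hasFDerivAt_convolution_right _ hl hf y).fderiv,
    convolution_precompR_apply _ hl (hc.fderiv ℝ) (hf.continuous_fderiv one_ne_zero)]
  rfl

lemma abs_mollify_le {f : Euc n → ℝ} (hf : Continuous f) {B : ℝ} (hB : ∀ y, |f y| ≤ B) (k : ℕ)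
    (y : Euc n) : |mollify k f y| ≤ B := by
  have dist_le := dist_convolution_le (μ := volume) (x₀ := y) ((abs_nonneg _).trans (hB y))
    (shrinkingBump n k).support_normed_eq.subset (shrinkingBump n k).nonneg_normed
    (shrinkingBump n k).integral_normed hf.aestronglyMeasurable
    fun x _ ↦ (Real.dist_0_eq_abs (f x)).trans_le (hB x)
  rwa [Real.dist_0_eq_abs] at dist_le

/-- The values which the partial derivatives of order one and two can take at a point. -/
abbrev TwoJet (n : ℕ) := (Fin n → ℝ) × (Fin n → Fin n → ℝ)

/-- The partial derivatives of `f` of order one and two at `y`. -/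
def twoJet (f : Euc n → ℝ) (y : Euc n) : TwoJet n :=
  (fun i ↦ partialDeriv i f y, fun i j ↦ partialDeriv i (partialDeriv j f) y)

lemma twoJet_congr {f h : Euc n → ℝ} {y : Euc n} (e : f =ᶠ[𝓝 y] h) :
    twoJet f y = twoJet h y := by
  simp only [twoJet, partialDeriv_congr _ e, partialDeriv_congr _ (partialDeriv_eventuallyEq _ e)]

lemma contDiff_partialDeriv {f : Euc n → ℝ} (hf : ContDiff ℝ 2 f) (i : Fin n) :
    ContDiff ℝ 1 (partialDeriv i f) :=
  contDiff_iff_contDiffAt.2 fun _ ↦ contDiffAt_partialDeriv hf.contDiffAt (by norm_num) i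

lemma continuous_twoJet {f : Euc n → ℝ} (hf : ContDiff ℝ 2 f) : Continuous (twoJet f) :=
  (continuous_pi fun i ↦ (contDiff_partialDeriv hf i).continuous).prodMk <|
    continuous_pi fun i ↦ continuous_pi fun j ↦
      continuous_partialDeriv (contDiff_partialDeriv hf j) i

lemma hasCompactSupport_partialDeriv {f : Euc n → ℝ} (hc : HasCompactSupport f) (i : Fin n) :
    HasCompactSupport (partialDeriv i f) :=
  hc.fderiv_apply (𝕜 := ℝ) _

lemma hasCompactSupport_twoJet {f : Euc n → ℝ} (hc : HasCompactSupport f) :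
    HasCompactSupport (twoJet f) := by
  have zero {y : Euc n} (hy : y ∉ tsupport f) (i : Fin n) : partialDeriv i f y = 0 :=
    partialDeriv_eq_zero_of_notMem (isClosed_tsupport f)
      (fun _ hz ↦ image_eq_zero_of_notMem_tsupport hz) hy i
  refine HasCompactSupport.intro hc fun y hy ↦ Prod.ext (funext (zero hy)) ?_
  exact funext fun i ↦ funext fun j ↦
    partialDeriv_eq_zero_of_notMem (isClosed_tsupport f) (fun _ hz ↦ zero hz j) hy i

lemma twoJet_mollify {f : Euc n → ℝ} (hf : ContDiff ℝ 2 f) (hc : HasCompactSupport f) (k : ℕ)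
    (y : Euc n) : twoJet (mollify k f) y = (fun i ↦ mollify k (partialDeriv i f) y,
      fun i j ↦ mollify k (partialDeriv i (partialDeriv j f)) y) := by
  have hf1 : ContDiff ℝ 1 f := hf.of_le (by norm_num)
  simp only [twoJet, partialDeriv_mollify hf1 hc,
    partialDeriv_mollify (contDiff_partialDeriv hf _) (hasCompactSupport_partialDeriv hc _)]

lemma tendsto_twoJet_mollify {f : Euc n → ℝ} (hf : ContDiff ℝ 2 f) (hc : HasCompactSupport f)
    (y : Euc n) : Tendsto (fun k ↦ twoJet (mollify k f) y) atTop (𝓝 (twoJet f y)) := by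
  simp only [twoJet_mollify hf hc]
  refine Tendsto.prodMk_nhds (tendsto_pi_nhds.2 fun i ↦ ?_)
    (tendsto_pi_nhds.2 fun i ↦ tendsto_pi_nhds.2 fun j ↦ ?_)
  · exact tendsto_mollify (contDiff_partialDeriv hf i).continuous y
  · exact tendsto_mollify (continuous_partialDeriv (contDiff_partialDeriv hf j) i) y

lemma norm_twoJet_mollify_le {f : Euc n → ℝ} (hf : ContDiff ℝ 2 f) (hc : HasCompactSupport f)
    {B : ℝ} (hB : ∀ y, ‖twoJet f y‖ ≤ B) (k : ℕ) (y : Euc n) :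
    ‖twoJet (mollify k f) y‖ ≤ B := by
  have hB0 : 0 ≤ B := (norm_nonneg _).trans (hB y)
  rw [twoJet_mollify hf hc, norm_prod_le_iff, pi_norm_le_iff_of_nonneg hB0,
    pi_norm_le_iff_of_nonneg hB0]
  refine ⟨fun i ↦ ?_, fun i ↦ (pi_norm_le_iff_of_nonneg hB0).2 fun j ↦ ?_⟩
  · exact abs_mollify_le (contDiff_partialDeriv hf i).continuous
      (fun z ↦ ((norm_le_pi_norm _ i).trans (norm_fst_le (twoJet f z))).trans (hB z)) k y
  · exact abs_mollify_le (continuous_partialDeriv (contDiff_partialDeriv hf j) i)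
      (fun z ↦ (((norm_le_pi_norm ((twoJet f z).2 i) j).trans (norm_le_pi_norm _ i)).trans
        (norm_snd_le (twoJet f z))).trans (hB z)) k y

lemma exists_contDiff_hasCompactSupport_eq {f : Euc n → ℝ} {U C : Set (Euc n)}
    {k : WithTop ℕ∞} (hk : k ≤ ∞) (hC : IsCompact C) (hU : IsOpen U) (hCU : C ⊆ U)
    (hf : ∀ y ∈ U, ContDiffAt ℝ k f y) :
    ∃ h : Euc n → ℝ, ContDiff ℝ k h ∧ HasCompactSupport h ∧ ∀ y ∈ C, h =ᶠ[𝓝 y] f := by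
  obtain ⟨D, hD, hCD, hDU⟩ := exists_compact_between hC hU hCU
  obtain ⟨χ, hχ1, hχ0, -⟩ := exists_contMDiffMap_one_nhds_of_subset_interior (n := ⊤)
    𝓘(ℝ, Euc n) hC.isClosed hCD
  have h0 : ∀ y ∉ D, χ y * f y = 0 := fun y hy ↦ by rw [hχ0 y hy, zero_mul]
  refine ⟨fun y ↦ χ y * f y, ?_, HasCompactSupport.intro hD h0, fun y hy ↦ ?_⟩
  · exact contDiff_of_contDiffAt_of_zero hD.isClosed hDU
      (fun y hy ↦ (χ.contMDiff.contDiff.contDiffAt.of_le hk).mul (hf y hy)) h0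
  · filter_upwards [(eventually_nhdsSet_iff_forall.1 hχ1) y hy] with z hz
    rw [hz, one_mul]

/-- `bochnerIntegrand` as a function of the point and of the partial derivatives of `f` there. -/
def bochnerJet (G : Euc n → Matrix (Fin n) (Fin n) ℝ) (K : ℝ) (w : Euc n → ℝ)
    (x : Euc n × TwoJet n) : ℝ :=
  let Γ := ∑ i, x.2.1 i * ∑ j, (G x.1)⁻¹ i j * x.2.1 j
  let Δ := ∑ i, ∑ j, (G x.1)⁻¹ i j * (x.2.2 i j - ∑ k, christoffel G k i j x.1 * x.2.1 k)
  Γ * laplacian G w x.1 / 2 + Δ * (∑ i, x.2.1 i * grad G w i x.1)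
    + w x.1 * (Δ ^ 2 - Δ ^ 2 / n) - K * w x.1 * Γ

lemma bochnerIntegrand_eq_bochnerJet (G : Euc n → Matrix (Fin n) (Fin n) ℝ) (K : ℝ)
    (w f : Euc n → ℝ) (y : Euc n) :
    bochnerIntegrand G K w f y = bochnerJet G K w (y, twoJet f y) := rfl

lemma bochnerIntegrand_eq_zero_of_notMem (G : Euc n → Matrix (Fin n) (Fin n) ℝ) (K : ℝ)
    {w : Euc n → ℝ} (f : Euc n → ℝ) {C : Set (Euc n)} (hC : IsClosed C) (h0 : ∀ y ∉ C, w y = 0)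
    {y : Euc n} (hy : y ∉ C) : bochnerIntegrand G K w f y = 0 := by
  have deriv_zero {z : Euc n} (hz : z ∉ C) (i : Fin n) : partialDeriv i w z = 0 :=
    partialDeriv_eq_zero_of_notMem hC h0 hz i
  have deriv_deriv_zero (i j : Fin n) : partialDeriv i (partialDeriv j w) y = 0 :=
    partialDeriv_eq_zero_of_notMem hC (fun z hz ↦ deriv_zero hz j) hy i
  simp [bochnerIntegrand, laplacian, hessian, gradInner, grad, h0 y hy, deriv_zero hy,
    deriv_deriv_zero]

namespace IsMetricOn

variable {G : Euc n → Matrix (Fin n) (Fin n) ℝ} {U C : Set (Euc n)} (hG : IsMetricOn G U)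
  {f w : Euc n → ℝ} (K : ℝ)

include hG

lemma continuousOn_bochnerJet (hw : ∀ y ∈ U, ContDiffAt ℝ 2 w y) :
    ContinuousOn (bochnerJet G K w) (U ×ˢ Set.univ) := by
  have continuousOn_fst {φ : Euc n → ℝ} (h : ∀ y ∈ U, ContinuousAt φ y) :
      ContinuousOn (fun x : Euc n × TwoJet n ↦ φ x.1) (U ×ˢ Set.univ) := fun x hx ↦
    ((h x.1 hx.1).comp continuousAt_fst).continuousWithinAt
  have hGinv (i j : Fin n) := continuousOn_fst fun y hy ↦ (hG.contDiffAt_inv hy i j).continuousAt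
  have hΓ (k i j : Fin n) := continuousOn_fst fun y hy ↦
    (hG.contDiffAt_christoffel hy k i j).continuousAt
  have hw0 := continuousOn_fst fun y hy ↦ (hw y hy).continuousAt
  have hgrad (i : Fin n) := continuousOn_fst fun y hy ↦
    (hG.contDiffAt_grad (r := 0) hy (hw y hy) (by norm_num) (by simp) i).continuousAt
  have hΔ := continuousOn_fst fun y hy ↦
    (hG.contDiffAt_laplacian (r := 0) hy (hw y hy) (by norm_num) (by simp)).continuousAt
  have hp (i : Fin n) : ContinuousOn (fun x : Euc n × TwoJet n ↦ x.2.1 i) (U ×ˢ Set.univ) := by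
    fun_prop
  have hA (i j : Fin n) : ContinuousOn (fun x : Euc n × TwoJet n ↦ x.2.2 i j)
      (U ×ˢ Set.univ) := by
    fun_prop
  have gradInner_part := continuousOn_finsetSum Finset.univ fun i _ ↦ (hp i).mul
    (continuousOn_finsetSum Finset.univ fun j _ ↦ (hGinv i j).mul (hp j))
  have laplacian_part := continuousOn_finsetSum Finset.univ fun i _ ↦
    continuousOn_finsetSum Finset.univ fun j _ ↦ (hGinv i j).mul ((hA i j).sub
      (continuousOn_finsetSum Finset.univ fun k _ ↦ (hΓ k i j).mul (hp k)))
  have gradInner_w_part := continuousOn_finsetSum Finset.univ fun i _ ↦ (hp i).mul (hgrad i)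
  exact (((gradInner_part.mul hΔ).div_const 2).add (laplacian_part.mul gradInner_w_part)).add
    (hw0.mul ((laplacian_part.pow 2).sub ((laplacian_part.pow 2).div_const _))) |>.sub
      ((continuousOn_const.mul hw0).mul gradInner_part)

section SupportedWeight

variable (hC : IsCompact C) (hCU : C ⊆ U) (hw : ∀ y ∈ U, ContDiffAt ℝ 2 w y)
  (h0 : ∀ y ∉ C, w y = 0)

include hC hCU hw h0

lemma tendsto_integral_bochnerIntegrand {F : ℕ → Euc n → ℝ} {B : ℝ}
    (hF : ∀ k, ContDiff ℝ 2 (F k))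
    (hlim : ∀ y, Tendsto (fun k ↦ twoJet (F k) y) atTop (𝓝 (twoJet f y)))
    (hB : ∀ k y, ‖twoJet (F k) y‖ ≤ B) :
    Tendsto (fun k ↦ ∫ y in U, bochnerIntegrand G K w (F k) y * volDensity G y) atTop
      (𝓝 (∫ y in U, bochnerIntegrand G K w f y * volDensity G y)) := by
  have hJ := hG.continuousOn_bochnerJet K hw
  obtain ⟨A, hA⟩ := (hC.prod (isCompact_closedBall (0 : TwoJet n) B)).exists_bound_of_continuousOn
    (hJ.mono (Set.prod_mono hCU (Set.subset_univ _)))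
  have continuousOn_integrand (k : ℕ) : ContinuousOn
      (fun y ↦ bochnerIntegrand G K w (F k) y * volDensity G y) U :=
    (hJ.comp (continuous_id.prodMk (continuous_twoJet (hF k))).continuousOn
      fun y hy ↦ ⟨hy, trivial⟩).mul hG.continuousOn_volDensity
  refine tendsto_integral_of_dominated_convergence (C.indicator fun y ↦ A * volDensity G y)
    (fun k ↦ (continuousOn_integrand k).aestronglyMeasurable hG.isOpen.measurableSet) ?_
    (fun k ↦ ?_) ?_
  · exact ((integrable_indicator_iff hC.measurableSet).2
      ((continuousOn_const.mul (hG.continuousOn_volDensity.mono hCU)).integrableOn_compact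
        hC)).mono_measure Measure.restrict_le_self
  · filter_upwards [ae_restrict_mem hG.isOpen.measurableSet] with y hy
    by_cases hyC : y ∈ C
    · rw [Set.indicator_of_mem hyC, norm_mul, Real.norm_of_nonneg (hG.volDensity_pos hy).le,
        bochnerIntegrand_eq_bochnerJet]
      exact mul_le_mul_of_nonneg_right (hA _ ⟨hyC, mem_closedBall_zero_iff.2 (hB k y)⟩)
        (hG.volDensity_pos hy).le
    · rw [bochnerIntegrand_eq_zero_of_notMem G K _ hC.isClosed h0 hyC,
        Set.indicator_of_notMem hyC, zero_mul, norm_zero]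
  · filter_upwards [ae_restrict_mem hG.isOpen.measurableSet] with y hy
    simp only [bochnerIntegrand_eq_bochnerJet]
    exact ((hJ.continuousAt ((hG.isOpen.prod isOpen_univ).mem_nhds ⟨hy, trivial⟩)).tendsto.comp
      (tendsto_const_nhds.prodMk_nhds (hlim y))).mul_const _

theorem integral_bochnerIntegrand_nonneg {K : ℝ} (hCD : ∀ y ∈ U, CurvatureDimensionAt G K y)
    (hf : ∀ y ∈ U, ContDiffAt ℝ 2 f y) (hw0 : ∀ y ∈ U, 0 ≤ w y) :
    0 ≤ ∫ y in U, bochnerIntegrand G K w f y * volDensity G y := by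
  obtain ⟨h, hh, hhc, hhf⟩ :=
    exists_contDiff_hasCompactSupport_eq ENat.LEInfty.out hC hG.isOpen hCU hf
  have integrand_eq (y : Euc n) : bochnerIntegrand G K w f y = bochnerIntegrand G K w h y := by
    by_cases hyC : y ∈ C
    · simp only [bochnerIntegrand_eq_bochnerJet, twoJet_congr (hhf y hyC)]
    · simp only [bochnerIntegrand_eq_zero_of_notMem G K _ hC.isClosed h0 hyC]
  simp only [integrand_eq]
  obtain ⟨B, hB⟩ := (hasCompactSupport_twoJet hhc).exists_bound_of_continuous
    (continuous_twoJet hh)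
  have hF (k : ℕ) : ContDiff ℝ ∞ (mollify k h) := contDiff_mollify hh.continuous k
  refine ge_of_tendsto' (hG.tendsto_integral_bochnerIntegrand K hC hCU hw h0
    (fun k ↦ (hF k).of_le ENat.LEInfty.out) (tendsto_twoJet_mollify hh hhc)
    (norm_twoJet_mollify_le hh hhc hB)) fun k ↦ ?_
  exact hG.integral_bochnerIntegrand_nonneg_of_contDiff hC hCU hCD
    (fun y _ ↦ (hF k).contDiffAt.of_le ENat.LEInfty.out) hw hw0 h0

end SupportedWeight

end IsMetricOn

end LocalGeometry

lemma contDiff_succ_of_hasDerivAt {𝕜 F : Type*} [NontriviallyNormedField 𝕜]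
    [NormedAddCommGroup F] [NormedSpace 𝕜 F] {k : ℕ} {f f' : 𝕜 → F}
    (hf : ∀ t, HasDerivAt f (f' t) t) (hf' : ContDiff 𝕜 k f') : ContDiff 𝕜 (k + 1) f := by
  rw [contDiff_succ_iff_deriv, funext fun t ↦ (hf t).deriv]
  exact ⟨fun t ↦ (hf t).differentiableAt, fun h ↦ absurd h (by simp), hf'⟩

namespace SmoothMetric

open Filter Topology Matrix MeasureTheory LocalGeometry

variable {n : ℕ} {M : Type*} [TopologicalSpace M]
  [ChartedSpace (EuclideanSpace ℝ (Fin n)) M] [IsManifold (𝓡 n) ∞ M]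

/-! ### Charts and their transition maps -/

/-- The scalar product at `x`, as a bilinear form on the model space `ℝⁿ` of the tangent space. -/
def modelInner (m : SmoothMetric n M) (x : M) : Euc n →L[ℝ] Euc n →L[ℝ] ℝ :=
  m.inner x

/-- The derivative of the inverse of the chart around `p`, as an endomorphism of the model space
`ℝⁿ` of the tangent spaces. -/
def chartDeriv (p : M) (y : Euc n) : Euc n →L[ℝ] Euc n :=
  mfderiv 𝓘(ℝ, Euc n) (𝓡 n) (extChartAt (𝓡 n) p).symm y

lemma sum_inChart (m : SmoothMetric n M) (p : M) (y v w : Euc n) :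
    ∑ i, ∑ j, m.inChart p y i j * v i * w j
      = m.modelInner ((extChartAt (𝓡 n) p).symm y) (chartDeriv p y v) (chartDeriv p y w) := by
  have sum_coord (v : Euc n) : v = ∑ i, v i • (EuclideanSpace.single i (1 : ℝ) : Euc n) := by
    simpa using ((EuclideanSpace.basisFun (Fin n) ℝ).sum_repr v).symm
  have inChart_apply (i j : Fin n) : m.inChart p y i j
      = m.modelInner ((extChartAt (𝓡 n) p).symm y) (chartDeriv p y (EuclideanSpace.single i 1))
        (chartDeriv p y (EuclideanSpace.single j 1)) := rfl
  conv_rhs => rw [sum_coord v, sum_coord w]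
  simp only [map_sum, map_smul, _root_.sum_apply, _root_.smul_apply,
    smul_eq_mul, inChart_apply, Finset.mul_sum]
  rw [Finset.sum_comm]
  exact Finset.sum_congr rfl fun i _ ↦ Finset.sum_congr rfl fun j _ ↦ by ring

section Chart

variable {p : M} {y : Euc n} (hy : y ∈ (extChartAt (𝓡 n) p).target)

include hy

lemma isInvertible_chartDeriv : (chartDeriv p y).IsInvertible := by
  have := isInvertible_mfderivWithin_extChartAt_symm (I := 𝓡 n) hy
  rwa [ModelWithCorners.range_eq_univ, mfderivWithin_univ] at this

lemma mdifferentiableAt_extChartAt_symm_of_mem :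
    MDifferentiableAt 𝓘(ℝ, Euc n) (𝓡 n) (extChartAt (𝓡 n) p).symm y := by
  have := mdifferentiableWithinAt_extChartAt_symm (I := 𝓡 n) hy
  rwa [ModelWithCorners.range_eq_univ, mdifferentiableWithinAt_univ] at this

lemma contMDiffAt_extChartAt_symm_of_mem :
    ContMDiffAt 𝓘(ℝ, Euc n) (𝓡 n) ∞ (extChartAt (𝓡 n) p).symm y :=
  (contMDiffOn_extChartAt_symm p).contMDiffAt ((isOpen_extChartAt_target p).mem_nhds hy)

lemma contMDiffAt_coordVec (i : Fin n) :
    ContMDiffAt 𝓘(ℝ, Euc n) ((𝓡 n).prod 𝓘(ℝ, Euc n)) ∞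
      (fun z ↦ Bundle.TotalSpace.mk' (Euc n) (E := fun x : M ↦ TangentSpace (𝓡 n) x)
        ((extChartAt (𝓡 n) p).symm z) (coordVec p z i)) y := by
  have isOpen_target : IsOpen (extChartAt (𝓡 n) p).target := isOpen_extChartAt_target p
  have tangentMap_smooth := (contMDiffOn_extChartAt_symm (I := 𝓡 n) (n := ∞)
    p).contMDiffOn_tangentMapWithin (m := ∞) (by simp) isOpen_target.uniqueMDiffOn
  have single_smooth := contMDiff_vectorSpace_iff_contDiff.2 (contDiff_const (𝕜 := ℝ) (n := ∞)
    (E := Euc n) (c := (EuclideanSpace.single i (1 : ℝ) : Euc n)))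
  have image_smooth := tangentMap_smooth.comp (s := (extChartAt (𝓡 n) p).target)
    single_smooth.contMDiffOn fun _ hz ↦ hz
  refine (image_smooth.contMDiffAt (isOpen_target.mem_nhds hy)).congr_of_eventuallyEq ?_
  filter_upwards [isOpen_target.mem_nhds hy] with z hz
  simp only [Function.comp_apply, tangentMapWithin, mfderivWithin_of_isOpen isOpen_target hz]
  rfl

lemma contDiffAt_inChart (m : SmoothMetric n M) (i j : Fin n) :
    ContDiffAt ℝ ∞ (fun z ↦ m.inChart p z i j) y := by
  have section_smooth : ContMDiffAt 𝓘(ℝ, Euc n) ((𝓡 n).prod 𝓘(ℝ)) ∞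
      (fun z ↦ Bundle.TotalSpace.mk' ℝ (E := Bundle.Trivial M ℝ) ((extChartAt (𝓡 n) p).symm z)
        (m.inner ((extChartAt (𝓡 n) p).symm z) (coordVec p z i) (coordVec p z j))) y := by
    apply ContMDiffAt.clm_bundle_apply₂ (F₁ := Euc n) (F₂ := Euc n)
    · exact ContMDiffAt.comp y m.contMDiff.contMDiffAt (contMDiffAt_extChartAt_symm_of_mem hy)
    · exact contMDiffAt_coordVec hy i
    · exact contMDiffAt_coordVec hy j
  exact (Bundle.contMDiffAt_totalSpace.1 section_smooth).2.contDiffAt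

lemma posDef_inChart (m : SmoothMetric n M) : (m.inChart p y).PosDef := by
  refine Matrix.PosDef.of_dotProduct_mulVec_pos ?_ fun v hv ↦ ?_
  · ext i j
    exact (star_trivial _).trans (m.symm _ _ _)
  · have quadratic_eq_sum : star v ⬝ᵥ (m.inChart p y *ᵥ v)
        = ∑ i, ∑ j, m.inChart p y i j * v i * v j := by
      simp only [dotProduct, Matrix.mulVec, Finset.mul_sum, star_trivial]
      exact Finset.sum_congr rfl fun i _ ↦ Finset.sum_congr rfl fun j _ ↦ by ring
    rw [quadratic_eq_sum]
    refine lt_of_lt_of_eq ?_ (m.sum_inChart p y (WithLp.toLp 2 v) (WithLp.toLp 2 v)).symm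
    refine m.pos _ _ fun h0 ↦ hv ?_
    simpa using
      (isInvertible_chartDeriv hy).injective (h0.trans (map_zero (chartDeriv p y)).symm)

end Chart

lemma isMetricOn_inChart (m : SmoothMetric n M) (p : M) :
    IsMetricOn (m.inChart p) (extChartAt (𝓡 n) p).target where
  isOpen := isOpen_extChartAt_target p
  contDiffAt _ hy i j := contDiffAt_inChart hy m i j
  posDef _ hy := posDef_inChart hy m

/-- The coordinate change from the chart around `p` to the chart around `q`. -/
def transition (p q : M) : Euc n → Euc n :=
  extChartAt (𝓡 n) q ∘ (extChartAt (𝓡 n) p).symm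

/-- The coordinates, in the chart around `p`, of the points where the chart around `q` is defined
too: the domain of `transition p q`. -/
def overlap (p q : M) : Set (Euc n) :=
  (extChartAt (𝓡 n) p).target ∩ (extChartAt (𝓡 n) p).symm ⁻¹' (extChartAt (𝓡 n) q).source

omit [IsManifold (𝓡 n) ∞ M] in
lemma isOpen_overlap (p q : M) : IsOpen (overlap (n := n) p q) :=
  (continuousOn_extChartAt_symm p).isOpen_inter_preimage (isOpen_extChartAt_target p)
    (isOpen_extChartAt_source q)

section Transition

variable {p q : M} {y : Euc n} (hy : y ∈ overlap p q)

include hy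

lemma contDiffAt_transition : ContDiffAt ℝ ∞ (transition p q) y :=
  ((contMDiffAt_extChartAt' ((extChartAt_source (𝓡 n) q).subset hy.2)).comp y
    (contMDiffAt_extChartAt_symm_of_mem hy.1)).contDiffAt

omit [IsManifold (𝓡 n) ∞ M] in
lemma transition_mem_target : transition p q y ∈ (extChartAt (𝓡 n) q).target :=
  (extChartAt (𝓡 n) q).map_source hy.2

omit [IsManifold (𝓡 n) ∞ M] in
lemma symm_transition :
    (extChartAt (𝓡 n) q).symm (transition p q y) = (extChartAt (𝓡 n) p).symm y :=
  (extChartAt (𝓡 n) q).left_inv hy.2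

omit [IsManifold (𝓡 n) ∞ M] in
lemma transition_mem_overlap : transition p q y ∈ overlap q p := by
  refine ⟨transition_mem_target hy, ?_⟩
  rw [Set.mem_preimage, symm_transition hy]
  exact (extChartAt (𝓡 n) p).map_target hy.1

omit [IsManifold (𝓡 n) ∞ M] in
lemma transition_transition : transition q p (transition p q y) = y := by
  rw [transition, Function.comp_apply, symm_transition hy]
  exact (extChartAt (𝓡 n) p).right_inv hy.1

lemma chartDeriv_eq_comp :
    chartDeriv p y = (chartDeriv q (transition p q y)).comp (fderiv ℝ (transition p q) y) := by
  have symm_eq : (extChartAt (𝓡 n) p).symm =ᶠ[𝓝 y]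
      (extChartAt (𝓡 n) q).symm ∘ transition p q := by
    filter_upwards [(isOpen_overlap p q).mem_nhds hy] with z hz using (symm_transition hz).symm
  have chain_rule :=
    (mdifferentiableAt_extChartAt_symm_of_mem (transition_mem_target hy)).hasMFDerivAt.comp y
      ((contDiffAt_transition hy).differentiableAt (by simp)).hasFDerivAt.hasMFDerivAt
  exact (chain_rule.congr_of_eventuallyEq symm_eq).mfderiv

lemma inChart_eq_transition (m : SmoothMetric n M) :
    m.inChart p y = (jacobian (transition p q) y)ᵀ * m.inChart q (transition p q y)
      * jacobian (transition p q) y := by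
  have dτ : DifferentiableAt ℝ (transition p q) y :=
    (contDiffAt_transition hy).differentiableAt (by simp)
  have fderiv_single (a i : Fin n) : fderiv ℝ (transition p q) y (EuclideanSpace.single i 1) a
      = jacobian (transition p q) y a i := by
    simp [fderiv_apply_eq_jacobian dτ]
  ext i j
  calc m.inChart p y i j
      = m.modelInner ((extChartAt (𝓡 n) p).symm y) (chartDeriv p y (EuclideanSpace.single i 1))
          (chartDeriv p y (EuclideanSpace.single j 1)) := rfl
    _ = ∑ a, ∑ b, m.inChart q (transition p q y) a b * jacobian (transition p q) y a i
          * jacobian (transition p q) y b j := by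
        rw [chartDeriv_eq_comp hy, ← symm_transition hy]
        simp only [ContinuousLinearMap.comp_apply]
        rw [← m.sum_inChart q]
        simp only [fderiv_single]
    _ = _ := by
        simp only [Matrix.mul_apply, Matrix.transpose_apply, Finset.sum_mul]
        rw [Finset.sum_comm]
        exact Finset.sum_congr rfl fun b _ ↦ Finset.sum_congr rfl fun a _ ↦ by ring

lemma eventually_inChart_eq_transition (m : SmoothMetric n M) :
    ∀ᶠ z in 𝓝 y, m.inChart p z = (jacobian (transition p q) z)ᵀ
      * m.inChart q (transition p q z) * jacobian (transition p q) z := by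
  filter_upwards [(isOpen_overlap p q).mem_nhds hy] with z hz using inChart_eq_transition hz m

end Transition

section OwnChart

variable {p x : M} (hx : x ∈ (extChartAt (𝓡 n) p).source)

include hx

omit [IsManifold (𝓡 n) ∞ M] in
lemma extChartAt_mem_overlap : extChartAt (𝓡 n) p x ∈ overlap p x := by
  refine ⟨(extChartAt (𝓡 n) p).map_source hx, ?_⟩
  rw [Set.mem_preimage, (extChartAt (𝓡 n) p).left_inv hx]
  exact mem_extChartAt_source x

omit [IsManifold (𝓡 n) ∞ M] in
lemma transition_extChartAt :
    transition p x (extChartAt (𝓡 n) p x) = extChartAt (𝓡 n) x x := by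
  rw [transition, Function.comp_apply, (extChartAt (𝓡 n) p).left_inv hx]

end OwnChart

/-- A function on `M` in the coordinates of the chart around `p`. -/
def read (p : M) (u : M → ℝ) : Euc n → ℝ := u ∘ (extChartAt (𝓡 n) p).symm

/-- The inner product `⟨∇u, ∇w⟩` at `x`, computed, like the Laplacian, in the chart around `x`. -/
def gradInner (m : SmoothMetric n M) (u w : M → ℝ) (x : M) : ℝ :=
  LocalGeometry.gradInner (m.inChart x) (read x u) (read x w) (extChartAt (𝓡 n) x x)

omit [IsManifold (𝓡 n) ∞ M] in
lemma read_extChartAt {p x : M} (hx : x ∈ (extChartAt (𝓡 n) p).source) (u : M → ℝ) :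
    read p u (extChartAt (𝓡 n) p x) = u x := by
  rw [read, Function.comp_apply, (extChartAt (𝓡 n) p).left_inv hx]

lemma contDiffAt_read {k : WithTop ℕ∞} (hk : k ≤ ∞) {p : M} {u : M → ℝ} {y : Euc n}
    (hy : y ∈ (extChartAt (𝓡 n) p).target)
    (hu : ContMDiffAt (𝓡 n) 𝓘(ℝ, ℝ) k u ((extChartAt (𝓡 n) p).symm y)) :
    ContDiffAt ℝ k (read p u) y :=
  (hu.comp y ((contMDiffAt_extChartAt_symm_of_mem hy).of_le hk)).contDiffAt

lemma contDiffAt_read_self {k : WithTop ℕ∞} (hk : k ≤ ∞) {x : M} {u : M → ℝ}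
    (hu : ContMDiffAt (𝓡 n) 𝓘(ℝ, ℝ) k u x) :
    ContDiffAt ℝ k (read x u) (extChartAt (𝓡 n) x x) :=
  contDiffAt_read hk (mem_extChartAt_target x)
    (by rwa [(extChartAt (𝓡 n) x).left_inv (mem_extChartAt_source x)])

omit [IsManifold (𝓡 n) ∞ M] in
lemma read_eq_read_transition {p q : M} {y : Euc n} (hy : y ∈ overlap p q) (u : M → ℝ) :
    read p u y = read q u (transition p q y) := by
  rw [read, read, Function.comp_apply, Function.comp_apply, symm_transition hy]

omit [IsManifold (𝓡 n) ∞ M] in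
lemma read_eventuallyEq {p q : M} {y : Euc n} (hy : y ∈ overlap p q) (u : M → ℝ) :
    read p u =ᶠ[𝓝 y] fun z ↦ read q u (transition p q z) := by
  filter_upwards [(isOpen_overlap p q).mem_nhds hy] with z hz using read_eq_read_transition hz u

section Operators

variable (m : SmoothMetric n M) {u w : M → ℝ}

section AnyChart

variable {p x : M} (hx : x ∈ (extChartAt (𝓡 n) p).source)

include hx

lemma laplacian_eq_chart (hu : ContMDiffAt (𝓡 n) 𝓘(ℝ, ℝ) 2 u x) :
    m.laplacian u x
      = LocalGeometry.laplacian (m.inChart p) (read p u) (extChartAt (𝓡 n) p x) := by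
  have hy := extChartAt_mem_overlap hx
  rw [laplacian_congr (read_eventuallyEq hy u),
    (m.isMetricOn_inChart p).laplacian_comp hy.1 (m.isMetricOn_inChart x)
      (transition_mem_target hy) ((contDiffAt_transition hy).of_le ENat.LEInfty.out)
      (eventually_inChart_eq_transition hy m), transition_extChartAt hx]
  · rfl
  · rw [transition_extChartAt hx]
    exact contDiffAt_read_self ENat.LEInfty.out hu

lemma gradInner_eq_chart (hu : ContMDiffAt (𝓡 n) 𝓘(ℝ, ℝ) 1 u x)
    (hw : ContMDiffAt (𝓡 n) 𝓘(ℝ, ℝ) 1 w x) :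
    m.gradInner u w x = LocalGeometry.gradInner (m.inChart p) (read p u) (read p w)
      (extChartAt (𝓡 n) p x) := by
  have hy := extChartAt_mem_overlap hx
  have differentiableAt_read {v : M → ℝ} (hv : ContMDiffAt (𝓡 n) 𝓘(ℝ, ℝ) 1 v x) :
      DifferentiableAt ℝ (read x v) (transition p x (extChartAt (𝓡 n) p x)) := by
    rw [transition_extChartAt hx]
    exact (contDiffAt_read_self ENat.LEInfty.out hv).differentiableAt one_ne_zero
  rw [gradInner_congr (read_eventuallyEq hy u) (read_eventuallyEq hy w),
    (m.isMetricOn_inChart p).gradInner_comp hy.1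
      ((contDiffAt_transition hy).differentiableAt (by simp)) (inChart_eq_transition hy m)
      (differentiableAt_read hu) (differentiableAt_read hw), transition_extChartAt hx]
  rfl

end AnyChart

lemma continuous_laplacian (hu : ContMDiff (𝓡 n) 𝓘(ℝ, ℝ) 2 u) : Continuous (m.laplacian u) := by
  refine continuous_iff_continuousAt.2 fun x ↦ ?_
  have continuousAt_local : ContinuousAt (LocalGeometry.laplacian (m.inChart x) (read x u))
      (extChartAt (𝓡 n) x x) :=
    ((m.isMetricOn_inChart x).contDiffAt_laplacian (r := 0) (mem_extChartAt_target x)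
      (contDiffAt_read_self ENat.LEInfty.out (hu x)) (by norm_num) (by simp)).continuousAt
  refine (continuousAt_local.comp (continuousAt_extChartAt x)).congr ?_
  filter_upwards [extChartAt_source_mem_nhds (I := 𝓡 n) x] with z hz
    using (m.laplacian_eq_chart hz (hu z)).symm

lemma continuous_gradInner (hu : ContMDiff (𝓡 n) 𝓘(ℝ, ℝ) 1 u)
    (hw : ContMDiff (𝓡 n) 𝓘(ℝ, ℝ) 1 w) : Continuous (m.gradInner u w) := by
  refine continuous_iff_continuousAt.2 fun x ↦ ?_
  have continuousAt_local :
      ContinuousAt (LocalGeometry.gradInner (m.inChart x) (read x u) (read x w))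
        (extChartAt (𝓡 n) x x) :=
    ((m.isMetricOn_inChart x).contDiffAt_gradInner (r := 0) (mem_extChartAt_target x)
      (contDiffAt_read_self ENat.LEInfty.out (hu x))
      (contDiffAt_read_self ENat.LEInfty.out (hw x)) (by norm_num) (by simp)).continuousAt
  refine (continuousAt_local.comp (continuousAt_extChartAt x)).congr ?_
  filter_upwards [extChartAt_source_mem_nhds (I := 𝓡 n) x] with z hz
    using (m.gradInner_eq_chart hz (hu z) (hw z)).symm

lemma laplacian_sum {ι : Type*} (s : Finset ι) {F : ι → M → ℝ} {x : M}
    (hF : ∀ a ∈ s, ContMDiffAt (𝓡 n) 𝓘(ℝ, ℝ) 2 (F a) x) :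
    m.laplacian (fun z ↦ ∑ a ∈ s, F a z) x = ∑ a ∈ s, m.laplacian (F a) x :=
  LocalGeometry.laplacian_sum s fun a ha ↦ contDiffAt_read_self ENat.LEInfty.out (hF a ha)

lemma gradInner_sum_right {ι : Type*} (s : Finset ι) {F : ι → M → ℝ} {x : M}
    (hF : ∀ a ∈ s, ContMDiffAt (𝓡 n) 𝓘(ℝ, ℝ) 1 (F a) x) :
    m.gradInner u (fun z ↦ ∑ a ∈ s, F a z) x = ∑ a ∈ s, m.gradInner u (F a) x :=
  LocalGeometry.gradInner_sum_right s fun a ha ↦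
    (contDiffAt_read_self ENat.LEInfty.out (hF a ha)).differentiableAt one_ne_zero

lemma laplacian_comp_real {H H' : ℝ → ℝ} {H'' : ℝ} {x : M} (hH : ∀ t, HasDerivAt H (H' t) t)
    (hH' : HasDerivAt H' H'' (u x)) (hu : ContMDiffAt (𝓡 n) 𝓘(ℝ, ℝ) 2 u x) :
    m.laplacian (fun z ↦ H (u z)) x = H' (u x) * m.laplacian u x + H'' * m.gradInner u u x := by
  have hx := read_extChartAt (mem_extChartAt_source (I := 𝓡 n) x) u
  have chain_rule := LocalGeometry.laplacian_comp_real (G := m.inChart x) hH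
    (by rw [hx]; exact hH') (contDiffAt_read_self ENat.LEInfty.out hu)
  rwa [hx] at chain_rule

lemma chartDeriv_extChartAt_self (x : M) :
    chartDeriv x (extChartAt (𝓡 n) x x) = ContinuousLinearMap.id ℝ (Euc n) := by
  have := mfderivWithin_range_extChartAt_symm (I := 𝓡 n) (x := x)
  rwa [ModelWithCorners.range_eq_univ, mfderivWithin_univ] at this

lemma vecCoord_self (x : M) (v : Euc n) : vecCoord x (v : TangentSpace (𝓡 n) x) = v := by
  simp only [vecCoord, mfderiv_extChartAt_self]
  rfl

lemma curvatureDimensionAt_inChart_self {K : ℝ} (hRic : m.RicciBoundedBelow K) (x : M) :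
    CurvatureDimensionAt (m.inChart x) K (extChartAt (𝓡 n) x x) := by
  refine (m.isMetricOn_inChart x).curvatureDimensionAt (mem_extChartAt_target x) fun v ↦ ?_
  have metric_eq := m.sum_inChart x (extChartAt (𝓡 n) x x) (WithLp.toLp 2 v) (WithLp.toLp 2 v)
  rw [chartDeriv_extChartAt_self,
    (extChartAt (𝓡 n) x).left_inv (mem_extChartAt_source x)] at metric_eq
  have ricci_ge := hRic x (WithLp.toLp 2 v : Euc n)
  simp only [SmoothMetric.ricci] at ricci_ge
  rw [vecCoord_self] at ricci_ge
  exact (congrArg (K * ·) metric_eq).trans_le ricci_ge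

lemma curvatureDimensionAt_inChart {K : ℝ} (hRic : m.RicciBoundedBelow K) {p : M} {y : Euc n}
    (hy : y ∈ (extChartAt (𝓡 n) p).target) : CurvatureDimensionAt (m.inChart p) K y := by
  set x := (extChartAt (𝓡 n) p).symm y
  have hxp : x ∈ (extChartAt (𝓡 n) p).source := (extChartAt (𝓡 n) p).map_target hy
  have hpx := extChartAt_mem_overlap hxp
  have hy_eq : extChartAt (𝓡 n) p x = y := (extChartAt (𝓡 n) p).right_inv hy
  have hxx : extChartAt (𝓡 n) x x ∈ overlap x p := by
    rw [← transition_extChartAt hxp]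
    exact transition_mem_overlap hpx
  have transition_eq : transition x p (extChartAt (𝓡 n) x x) = y := by
    rw [← transition_extChartAt hxp, transition_transition hpx, hy_eq]
  rw [← transition_eq]
  exact (m.isMetricOn_inChart x).curvatureDimensionAt_comp hxx.1 (m.isMetricOn_inChart p)
    (transition_mem_target hxx) ((contDiffAt_transition hxx).of_le ENat.LEInfty.out)
    (eventually_inChart_eq_transition hxx m) (m.curvatureDimensionAt_inChart_self hRic x)

end Operators

/-! ### Integration with respect to the Riemannian volume -/

/-- The integral, with respect to the Riemannian volume, of a function over the domain of the chart
around `p`. -/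
def chartIntegral (m : SmoothMetric n M) (p : M) (f : M → ℝ) : ℝ :=
  ∫ y in (extChartAt (𝓡 n) p).target, read p f y * volDensity (m.inChart p) y

lemma volDensity_transition (m : SmoothMetric n M) {p q : M} {y : Euc n} (hy : y ∈ overlap p q) :
    volDensity (m.inChart p) y = |(fderiv ℝ (transition p q) y).det|
      * volDensity (m.inChart q) (transition p q y) := by
  rw [det_fderiv_eq_det_jacobian ((contDiffAt_transition hy).differentiableAt (by simp)),
    volDensity, volDensity, inChart_eq_transition hy, Matrix.det_mul, Matrix.det_mul,
    Matrix.det_transpose, mul_right_comm, ← sq, Real.sqrt_mul (sq_nonneg _), Real.sqrt_sq_eq_abs]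

omit [IsManifold (𝓡 n) ∞ M] in
lemma image_transition_overlap (p q : M) :
    transition (n := n) p q '' overlap p q = overlap q p := by
  refine Set.Subset.antisymm (Set.image_subset_iff.2 fun y hy ↦ transition_mem_overlap hy)
    fun y hy ↦ ⟨transition q p y, transition_mem_overlap hy, transition_transition hy⟩

lemma chartIntegral_eq_integral_overlap (m : SmoothMetric n M) (p : M) {q : M} {f : M → ℝ}
    (hq : ∀ x ∉ (extChartAt (𝓡 n) q).source, f x = 0) :
    m.chartIntegral p f = ∫ y in overlap p q, read p f y * volDensity (m.inChart p) y := by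
  refine setIntegral_eq_of_subset_of_forall_sdiff_eq_zero
    (isOpen_extChartAt_target p).measurableSet Set.inter_subset_left fun y hy ↦ ?_
  have hyq : (extChartAt (𝓡 n) p).symm y ∉ (extChartAt (𝓡 n) q).source := fun h ↦ hy.2 ⟨hy.1, h⟩
  rw [read, Function.comp_apply, hq _ hyq, zero_mul]

lemma chartIntegral_eq (m : SmoothMetric n M) {p q : M} {f : M → ℝ}
    (hp : ∀ x ∉ (extChartAt (𝓡 n) p).source, f x = 0)
    (hq : ∀ x ∉ (extChartAt (𝓡 n) q).source, f x = 0) :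
    m.chartIntegral p f = m.chartIntegral q f := by
  have measurableSet_overlap : MeasurableSet (overlap (n := n) p q) :=
    (isOpen_overlap p q).measurableSet
  have injOn_transition : Set.InjOn (transition (n := n) p q) (overlap p q) :=
    Set.LeftInvOn.injOn fun _ hy ↦ transition_transition hy
  rw [m.chartIntegral_eq_integral_overlap p hq, m.chartIntegral_eq_integral_overlap q hp,
    ← image_transition_overlap p q,
    integral_image_eq_integral_abs_det_fderiv_smul volume measurableSet_overlap
      (fun y hy ↦ ((contDiffAt_transition hy).differentiableAt
        (by simp)).hasFDerivAt.hasFDerivWithinAt) injOn_transition]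
  refine setIntegral_congr_fun measurableSet_overlap fun y hy ↦ ?_
  simp only [smul_eq_mul, m.volDensity_transition hy, read_eq_read_transition hy]
  ring

section Compact

variable [CompactSpace M] (m : SmoothMetric n M) {p : M} {f h : M → ℝ}

omit [IsManifold (𝓡 n) ∞ M] in
lemma isCompact_image_tsupport (hs : tsupport f ⊆ (extChartAt (𝓡 n) p).source) :
    IsCompact (extChartAt (𝓡 n) p '' tsupport f) :=
  (isClosed_tsupport f).isCompact.image_of_continuousOn ((continuousOn_extChartAt p).mono hs)

omit [IsManifold (𝓡 n) ∞ M] [CompactSpace M] in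
lemma image_tsupport_subset (hs : tsupport f ⊆ (extChartAt (𝓡 n) p).source) :
    extChartAt (𝓡 n) p '' tsupport f ⊆ (extChartAt (𝓡 n) p).target :=
  Set.image_subset_iff.2 fun _ hx ↦ (extChartAt (𝓡 n) p).map_source (hs hx)

/-- A function supported in the chart around `p`, in the coordinates of this chart and extended by
zero to `ℝⁿ`. -/
def readExt (p : M) (f : M → ℝ) : Euc n → ℝ :=
  (extChartAt (𝓡 n) p).target.indicator (read p f)

omit [IsManifold (𝓡 n) ∞ M] [CompactSpace M] in
lemma readExt_eq_zero_of_notMem {y : Euc n} (hy : y ∉ extChartAt (𝓡 n) p '' tsupport f) :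
    readExt p f y = 0 := by
  refine Set.indicator_apply_eq_zero.2 fun hyt ↦ ?_
  by_contra h0
  exact hy ⟨_, subset_tsupport f h0, (extChartAt (𝓡 n) p).right_inv hyt⟩

omit [IsManifold (𝓡 n) ∞ M] [CompactSpace M] in
lemma eqOn_readExt (p : M) (f : M → ℝ) :
    Set.EqOn (readExt p f) (read p f) (extChartAt (𝓡 n) p).target :=
  Set.eqOn_indicator

lemma integrableOn_read (hf : Continuous f) (hs : tsupport f ⊆ (extChartAt (𝓡 n) p).source) :
    IntegrableOn (fun y ↦ read p f y * volDensity (m.inChart p) y)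
      (extChartAt (𝓡 n) p).target := by
  have continuousOn_readExt : ContinuousOn (readExt p f) (extChartAt (𝓡 n) p).target :=
    (hf.comp_continuousOn (continuousOn_extChartAt_symm p)).congr (eqOn_readExt p f)
  refine ((m.isMetricOn_inChart p).integrableOn_mul_volDensity (isCompact_image_tsupport hs)
    (image_tsupport_subset hs) continuousOn_readExt
    fun y hy ↦ readExt_eq_zero_of_notMem hy).congr_fun (fun y hy ↦ ?_)
    (isOpen_extChartAt_target p).measurableSet
  simp only [eqOn_readExt p f hy]

lemma chartIntegral_add (hf : Continuous f) (hs : tsupport f ⊆ (extChartAt (𝓡 n) p).source)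
    (hh : Continuous h) (hsh : tsupport h ⊆ (extChartAt (𝓡 n) p).source) :
    m.chartIntegral p (fun x ↦ f x + h x) = m.chartIntegral p f + m.chartIntegral p h := by
  simp only [chartIntegral]
  rw [← integral_add (m.integrableOn_read hf hs) (m.integrableOn_read hh hsh)]
  simp only [read, Function.comp_apply, add_mul]

omit [CompactSpace M] in
lemma chartIntegral_const_mul (c : ℝ) :
    m.chartIntegral p (fun x ↦ c * f x) = c * m.chartIntegral p f := by
  simp only [chartIntegral, ← integral_const_mul, read, Function.comp_apply, mul_assoc]

lemma chartIntegral_sum {ι : Type*} (s : Finset ι) {F : ι → M → ℝ}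
    (hF : ∀ a ∈ s, Continuous (F a))
    (hs : ∀ a ∈ s, tsupport (F a) ⊆ (extChartAt (𝓡 n) p).source) :
    m.chartIntegral p (fun x ↦ ∑ a ∈ s, F a x) = ∑ a ∈ s, m.chartIntegral p (F a) := by
  simp only [chartIntegral]
  rw [← integral_finsetSum _ fun a ha ↦ m.integrableOn_read (hF a ha) (hs a ha)]
  simp only [read, Function.comp_apply, Finset.sum_mul]

omit [CompactSpace M] in
lemma read_mul_volDensity_nonneg (h0 : ∀ x, 0 ≤ f x) {y : Euc n}
    (hy : y ∈ (extChartAt (𝓡 n) p).target) : 0 ≤ read p f y * volDensity (m.inChart p) y :=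
  mul_nonneg (h0 _) ((m.isMetricOn_inChart p).volDensity_pos hy).le

omit [CompactSpace M] in
lemma chartIntegral_nonneg (h0 : ∀ x, 0 ≤ f x) : 0 ≤ m.chartIntegral p f :=
  setIntegral_nonneg (isOpen_extChartAt_target p).measurableSet fun _ hy ↦
    m.read_mul_volDensity_nonneg h0 hy

lemma eq_zero_of_chartIntegral_eq_zero (hf : Continuous f)
    (hs : tsupport f ⊆ (extChartAt (𝓡 n) p).source) (h0 : ∀ x, 0 ≤ f x)
    (hi : m.chartIntegral p f = 0) (x : M) : f x = 0 := by
  by_cases hx : x ∈ (extChartAt (𝓡 n) p).source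
  swap
  · exact image_eq_zero_of_notMem_tsupport fun h ↦ hx (hs h)
  have hG := m.isMetricOn_inChart p
  have integrand_ae_eq_zero := (setIntegral_eq_zero_iff_of_nonneg_ae
    (ae_restrict_of_forall_mem hG.isOpen.measurableSet fun _ hy ↦
      m.read_mul_volDensity_nonneg h0 hy) (m.integrableOn_read hf hs)).1 hi
  have continuousOn_integrand :
      ContinuousOn (fun y ↦ read p f y * volDensity (m.inChart p) y)
        (extChartAt (𝓡 n) p).target :=
    (hf.comp_continuousOn (continuousOn_extChartAt_symm p)).mul hG.continuousOn_volDensity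
  have hy := (extChartAt (𝓡 n) p).map_source hx
  have integrand_eq_zero := Measure.eqOn_open_of_ae_eq integrand_ae_eq_zero hG.isOpen
    continuousOn_integrand continuousOn_const hy
  rw [← read_extChartAt hx f]
  exact (mul_eq_zero.1 integrand_eq_zero).resolve_right (hG.volDensity_pos hy).ne'

end Compact

lemma exists_partition_subordinate_charts (n : ℕ) (M : Type*) [TopologicalSpace M]
    [ChartedSpace (EuclideanSpace ℝ (Fin n)) M] [IsManifold (𝓡 n) ∞ M]
    [T2Space M] [CompactSpace M] :
    ∃ (t : Finset M) (ρ : SmoothPartitionOfUnity t (𝓡 n) M Set.univ),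
      ρ.IsSubordinate fun p ↦ (extChartAt (𝓡 n) (p : M)).source := by
  obtain ⟨t, -, univ_subset⟩ := isCompact_univ.elim_nhds_subcover
    (fun p : M ↦ (extChartAt (𝓡 n) p).source) fun p _ ↦ extChartAt_source_mem_nhds p
  refine ⟨t, SmoothPartitionOfUnity.exists_isSubordinate (𝓡 n) isClosed_univ
    (fun p : t ↦ (extChartAt (𝓡 n) (p : M)).source) (fun p ↦ isOpen_extChartAt_source _)
    fun x hx ↦ ?_⟩
  obtain ⟨p, hp, hxp⟩ := Set.mem_iUnion₂.1 (univ_subset hx)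
  exact Set.mem_iUnion.2 ⟨⟨p, hp⟩, hxp⟩

section VolIntegral

variable {t : Finset M} (ρ : SmoothPartitionOfUnity t (𝓡 n) M Set.univ)

/-- The integral of a function with respect to the Riemannian volume, computed chart by chart with
a partition of unity; this is meaningful when the partition is subordinate to the chart domains. -/
def volIntegral (m : SmoothMetric n M) (f : M → ℝ) : ℝ :=
  ∑ p : t, m.chartIntegral p fun x ↦ ρ p x * f x

omit [IsManifold (𝓡 n) ∞ M] in
lemma sum_partition (x : M) : ∑ p, ρ p x = 1 := by
  rw [← finsum_eq_sum_of_fintype, ρ.sum_eq_one (Set.mem_univ x)]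

omit [IsManifold (𝓡 n) ∞ M] in
lemma sum_partition_mul (f : M → ℝ) (x : M) : ∑ p, ρ p x * f x = f x := by
  rw [← Finset.sum_mul, sum_partition, one_mul]

omit [IsManifold (𝓡 n) ∞ M] in
lemma continuous_partition_mul {f : M → ℝ} (hf : Continuous f) (p : t) :
    Continuous fun x ↦ ρ p x * f x :=
  (ρ p).contMDiff.continuous.mul hf

variable {ρ} (hρ : ρ.IsSubordinate fun p ↦ (extChartAt (𝓡 n) (p : M)).source)
include hρ

omit [IsManifold (𝓡 n) ∞ M] in
lemma tsupport_partition_mul_subset (p : t) (f : M → ℝ) :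
    tsupport (fun x ↦ ρ p x * f x) ⊆ (extChartAt (𝓡 n) (p : M)).source :=
  (tsupport_mul_subset_left (f := ρ p) (g := f)).trans (hρ p)

omit hρ in
lemma volIntegral_const_mul (m : SmoothMetric n M) {f : M → ℝ} (c : ℝ) :
    m.volIntegral ρ (fun x ↦ c * f x) = c * m.volIntegral ρ f := by
  simp only [volIntegral, Finset.mul_sum, ← chartIntegral_const_mul, mul_left_comm]

variable [CompactSpace M] (m : SmoothMetric n M) {f h : M → ℝ} {q : M}

lemma volIntegral_add (hf : Continuous f) (hh : Continuous h) :
    m.volIntegral ρ (fun x ↦ f x + h x) = m.volIntegral ρ f + m.volIntegral ρ h := by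
  simp only [volIntegral, ← Finset.sum_add_distrib, mul_add]
  exact Finset.sum_congr rfl fun p _ ↦ m.chartIntegral_add
    (continuous_partition_mul ρ hf p) (tsupport_partition_mul_subset hρ p f)
    (continuous_partition_mul ρ hh p) (tsupport_partition_mul_subset hρ p h)

lemma volIntegral_sum {κ : Type*} (s : Finset κ) {F : κ → M → ℝ}
    (hF : ∀ a ∈ s, Continuous (F a)) :
    m.volIntegral ρ (fun x ↦ ∑ a ∈ s, F a x) = ∑ a ∈ s, m.volIntegral ρ (F a) := by
  simp only [volIntegral, Finset.mul_sum]
  rw [Finset.sum_comm]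
  exact Finset.sum_congr rfl fun p _ ↦ m.chartIntegral_sum s
    (fun a ha ↦ continuous_partition_mul ρ (hF a ha) p)
    fun a _ ↦ tsupport_partition_mul_subset hρ p (F a)

lemma volIntegral_eq_chartIntegral (hf : Continuous f)
    (hs : tsupport f ⊆ (extChartAt (𝓡 n) q).source) :
    m.volIntegral ρ f = m.chartIntegral q f := by
  have tsupport_mul_subset (p : t) :
      tsupport (fun x ↦ ρ p x * f x) ⊆ (extChartAt (𝓡 n) q).source :=
    (tsupport_mul_subset_right (f := ρ p) (g := f)).trans hs
  have chartIntegral_mul_eq (p : t) : m.chartIntegral p (fun x ↦ ρ p x * f x)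
      = m.chartIntegral q fun x ↦ ρ p x * f x :=
    m.chartIntegral_eq
      (fun x hx ↦ image_eq_zero_of_notMem_tsupport (f := fun x ↦ ρ p x * f x)
        fun h ↦ hx (tsupport_partition_mul_subset hρ p f h))
      (fun x hx ↦ image_eq_zero_of_notMem_tsupport (f := fun x ↦ ρ p x * f x)
        fun h ↦ hx (tsupport_mul_subset p h))
  simp only [volIntegral, chartIntegral_mul_eq]
  rw [← m.chartIntegral_sum _ (F := fun p x ↦ ρ p x * f x)
    (fun p _ ↦ continuous_partition_mul ρ hf p) fun p _ ↦ tsupport_mul_subset p]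
  simp only [sum_partition_mul]

lemma eq_zero_of_volIntegral_eq_zero (hf : Continuous f) (h0 : ∀ x, 0 ≤ f x)
    (hi : m.volIntegral ρ f = 0) (x : M) : f x = 0 := by
  have mul_nonneg_of_partition (p : t) (x : M) : 0 ≤ ρ p x * f x :=
    mul_nonneg (ρ.nonneg p x) (h0 x)
  have chartIntegral_eq_zero := (Finset.sum_eq_zero_iff_of_nonneg fun p _ ↦
    m.chartIntegral_nonneg (mul_nonneg_of_partition p)).1 hi
  rw [← sum_partition_mul ρ f x]
  exact Finset.sum_eq_zero fun p hp ↦ m.eq_zero_of_chartIntegral_eq_zero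
    (continuous_partition_mul ρ hf p) (tsupport_partition_mul_subset hρ p f)
    (mul_nonneg_of_partition p) (chartIntegral_eq_zero p hp) x

lemma eq_zero_of_volIntegral_nonneg (hf : Continuous f) (h0 : ∀ x, f x ≤ 0)
    (hi : 0 ≤ m.volIntegral ρ f) (x : M) : f x = 0 := by
  have volIntegral_neg : m.volIntegral ρ (fun x ↦ -f x) = -m.volIntegral ρ f := by
    simpa only [neg_one_mul] using m.volIntegral_const_mul (ρ := ρ) (f := f) (-1)
  have volIntegral_neg_nonneg : 0 ≤ m.volIntegral ρ fun x ↦ -f x :=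
    Finset.sum_nonneg fun p _ ↦ m.chartIntegral_nonneg fun x ↦
      mul_nonneg (ρ.nonneg p x) (neg_nonneg.2 (h0 x))
  have volIntegral_neg_eq_zero : m.volIntegral ρ (fun x ↦ -f x) = 0 := by linarith
  exact neg_eq_zero.1 <| m.eq_zero_of_volIntegral_eq_zero (f := fun x ↦ -f x) hρ hf.neg
    (fun x ↦ neg_nonneg.2 (h0 x)) volIntegral_neg_eq_zero x

end VolIntegral

/-! ### The weighted Bochner inequality on a compact manifold -/

section WeightedBochner

variable (m : SmoothMetric n M) {u w : M → ℝ} {p x : M}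

omit [IsManifold (𝓡 n) ∞ M] in
lemma read_eventuallyEq_zero (hx : x ∉ tsupport w) :
    read x w =ᶠ[𝓝 (extChartAt (𝓡 n) x x)] fun _ ↦ 0 := by
  have tendsto_symm := (continuousAt_extChartAt_symm (I := 𝓡 n) x).tendsto
  rw [extChartAt_to_inv] at tendsto_symm
  exact tendsto_symm.eventually (notMem_tsupport_iff_eventuallyEq.1 hx)

lemma laplacian_eq_zero_of_notMem (hx : x ∉ tsupport w) : m.laplacian w x = 0 := by
  have partialDeriv_zero (j : Fin n) : partialDeriv j (fun _ : Euc n ↦ (0 : ℝ)) = fun _ ↦ 0 :=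
    funext fun y ↦ partialDeriv_const j 0
  refine (laplacian_congr (read_eventuallyEq_zero hx)).trans ?_
  simp [LocalGeometry.laplacian, hessian, partialDeriv_zero]

lemma gradInner_eq_zero_of_notMem (hx : x ∉ tsupport w) : m.gradInner u w x = 0 := by
  refine (gradInner_congr (EventuallyEq.refl _ _) (read_eventuallyEq_zero hx)).trans ?_
  simp [LocalGeometry.gradInner, grad, partialDeriv_const]

lemma tsupport_laplacian_subset : tsupport (m.laplacian w) ⊆ tsupport w :=
  closure_minimal (Function.support_subset_iff'.2 fun _ ↦ m.laplacian_eq_zero_of_notMem)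
    (isClosed_tsupport w)

/-- The integrand of the weighted Bochner inequality on `M`, for a function `u` and a weight
`w`. -/
def bochnerIntegrand (K : ℝ) (w u : M → ℝ) (x : M) : ℝ :=
  m.gradInner u u x * m.laplacian w x / 2 + m.laplacian u x * m.gradInner u w x
    + w x * (m.laplacian u x ^ 2 - m.laplacian u x ^ 2 / n) - K * w x * m.gradInner u u x

lemma tsupport_bochnerIntegrand_subset (K : ℝ) :
    tsupport (m.bochnerIntegrand K w u) ⊆ tsupport w := by
  refine closure_minimal (Function.support_subset_iff'.2 fun x hx ↦ ?_) (isClosed_tsupport w)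
  simp [bochnerIntegrand, m.laplacian_eq_zero_of_notMem hx, m.gradInner_eq_zero_of_notMem hx,
    image_eq_zero_of_notMem_tsupport hx]

lemma continuous_bochnerIntegrand (K : ℝ) (hw : ContMDiff (𝓡 n) 𝓘(ℝ, ℝ) 2 w)
    (hu : ContMDiff (𝓡 n) 𝓘(ℝ, ℝ) 2 u) : Continuous (m.bochnerIntegrand K w u) := by
  have hu1 := hu.of_le one_le_two
  have continuous_laplacian_u := m.continuous_laplacian hu
  have continuous_laplacian_w := m.continuous_laplacian hw
  have continuous_gradInner_self := m.continuous_gradInner hu1 hu1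
  have continuous_gradInner_uw := m.continuous_gradInner hu1 (hw.of_le one_le_two)
  have continuous_w := hw.continuous
  unfold bochnerIntegrand
  fun_prop

omit [IsManifold (𝓡 n) ∞ M] in
lemma readExt_eventuallyEq {y : Euc n} (hy : y ∈ (extChartAt (𝓡 n) p).target) :
    readExt p w =ᶠ[𝓝 y] read p w :=
  (eqOn_readExt p w).eventuallyEq_of_mem ((isOpen_extChartAt_target p).mem_nhds hy)

lemma contDiffAt_readExt (hw : ContMDiff (𝓡 n) 𝓘(ℝ, ℝ) 2 w) {y : Euc n}
    (hy : y ∈ (extChartAt (𝓡 n) p).target) : ContDiffAt ℝ 2 (readExt p w) y :=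
  (contDiffAt_read ENat.LEInfty.out hy (hw _)).congr_of_eventuallyEq (readExt_eventuallyEq hy)

lemma read_laplacian (hw : ContMDiff (𝓡 n) 𝓘(ℝ, ℝ) 2 w) {y : Euc n}
    (hy : y ∈ (extChartAt (𝓡 n) p).target) :
    read p (m.laplacian w) y = LocalGeometry.laplacian (m.inChart p) (readExt p w) y := by
  have laplacian_eq := m.laplacian_eq_chart ((extChartAt (𝓡 n) p).map_target hy) (hw _)
  rwa [(extChartAt (𝓡 n) p).right_inv hy, ← laplacian_congr (readExt_eventuallyEq hy)]
    at laplacian_eq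

lemma read_gradInner (hu : ContMDiff (𝓡 n) 𝓘(ℝ, ℝ) 1 u) (hw : ContMDiff (𝓡 n) 𝓘(ℝ, ℝ) 1 w)
    {y : Euc n} (hy : y ∈ (extChartAt (𝓡 n) p).target) :
    read p (m.gradInner u w) y
      = LocalGeometry.gradInner (m.inChart p) (readExt p u) (readExt p w) y := by
  have gradInner_eq := m.gradInner_eq_chart ((extChartAt (𝓡 n) p).map_target hy) (hu _) (hw _)
  rwa [(extChartAt (𝓡 n) p).right_inv hy,
    ← gradInner_congr (readExt_eventuallyEq hy) (readExt_eventuallyEq hy)] at gradInner_eq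

lemma read_bochnerIntegrand (K : ℝ) (hu : ContMDiff (𝓡 n) 𝓘(ℝ, ℝ) 2 u)
    (hw : ContMDiff (𝓡 n) 𝓘(ℝ, ℝ) 2 w) {y : Euc n} (hy : y ∈ (extChartAt (𝓡 n) p).target) :
    read p (m.bochnerIntegrand K w u) y
      = LocalGeometry.bochnerIntegrand (m.inChart p) K (readExt p w) (readExt p u) y := by
  have hu1 := hu.of_le one_le_two
  simp only [LocalGeometry.bochnerIntegrand, eqOn_readExt p w hy, ← m.read_laplacian hu hy,
    ← m.read_laplacian hw hy, ← m.read_gradInner hu1 hu1 hy,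
    ← m.read_gradInner hu1 (hw.of_le one_le_two) hy]
  rfl

variable [CompactSpace M]

lemma chartIntegral_laplacian (hw : ContMDiff (𝓡 n) 𝓘(ℝ, ℝ) 2 w)
    (hs : tsupport w ⊆ (extChartAt (𝓡 n) p).source) :
    m.chartIntegral p (m.laplacian w) = 0 := by
  have hG := m.isMetricOn_inChart p
  have hC := isCompact_image_tsupport hs
  rw [← hG.integral_divergence_eq_zero (X := grad (m.inChart p) (readExt p w)) hC
    (image_tsupport_subset hs)
    (fun y hy k ↦ hG.contDiffAt_grad hy (contDiffAt_readExt hw hy) (by norm_num) (by simp) k)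
    (fun k y hy ↦ grad_eq_zero_of_notMem _ hC.isClosed
      (fun z hz ↦ readExt_eq_zero_of_notMem hz) hy k)]
  refine setIntegral_congr_fun hG.isOpen.measurableSet fun y hy ↦ ?_
  simp only [m.read_laplacian hw hy, hG.laplacian_eq_divergence_grad hy (contDiffAt_readExt hw hy)]

lemma chartIntegral_bochnerIntegrand_nonneg {K : ℝ} (hRic : m.RicciBoundedBelow K)
    (hu : ContMDiff (𝓡 n) 𝓘(ℝ, ℝ) 2 u) (hw : ContMDiff (𝓡 n) 𝓘(ℝ, ℝ) 2 w) (hw0 : ∀ x, 0 ≤ w x)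
    (hs : tsupport w ⊆ (extChartAt (𝓡 n) p).source) :
    0 ≤ m.chartIntegral p (m.bochnerIntegrand K w u) := by
  have hG := m.isMetricOn_inChart p
  refine (hG.integral_bochnerIntegrand_nonneg (K := K) (f := readExt p u) (w := readExt p w)
    (isCompact_image_tsupport hs) (image_tsupport_subset hs)
    (fun y hy ↦ contDiffAt_readExt hw hy) (fun y hy ↦ readExt_eq_zero_of_notMem hy)
    (fun y hy ↦ m.curvatureDimensionAt_inChart hRic hy) (fun y hy ↦ contDiffAt_readExt hu hy)
    fun y hy ↦ (hw0 _).trans_eq (eqOn_readExt p w hy).symm).trans_eq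
    (setIntegral_congr_fun hG.isOpen.measurableSet fun y hy ↦ ?_)
  simp only [m.read_bochnerIntegrand K hu hw hy]

variable {t : Finset M} {ρ : SmoothPartitionOfUnity t (𝓡 n) M Set.univ}

omit [IsManifold (𝓡 n) ∞ M] [CompactSpace M] in
lemma contMDiff_partition_mul (hw : ContMDiff (𝓡 n) 𝓘(ℝ, ℝ) 2 w) (p : t) :
    ContMDiff (𝓡 n) 𝓘(ℝ, ℝ) 2 fun x ↦ ρ p x * w x :=
  ((ρ p).contMDiff.of_le ENat.LEInfty.out).mul hw

omit [CompactSpace M] in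
lemma sum_laplacian_partition_mul (hw : ContMDiff (𝓡 n) 𝓘(ℝ, ℝ) 2 w) (x : M) :
    ∑ p, m.laplacian (fun z ↦ ρ p z * w z) x = m.laplacian w x := by
  rw [← m.laplacian_sum _ fun p _ ↦ contMDiff_partition_mul hw p x]
  simp only [sum_partition_mul]

omit [CompactSpace M] in
lemma sum_bochnerIntegrand_partition_mul (K : ℝ) (hw : ContMDiff (𝓡 n) 𝓘(ℝ, ℝ) 2 w) (x : M) :
    ∑ p, m.bochnerIntegrand K (fun z ↦ ρ p z * w z) u x = m.bochnerIntegrand K w u x := by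
  have sum_gradInner : ∑ p, m.gradInner u (fun z ↦ ρ p z * w z) x = m.gradInner u w x := by
    rw [← m.gradInner_sum_right _ fun p _ ↦
      ((contMDiff_partition_mul hw p).of_le one_le_two) x]
    simp only [sum_partition_mul]
  simp only [bochnerIntegrand, Finset.sum_add_distrib, Finset.sum_sub_distrib, ← Finset.sum_div,
    ← Finset.mul_sum, ← Finset.sum_mul, m.sum_laplacian_partition_mul hw, sum_gradInner,
    sum_partition, one_mul]

variable (hρ : ρ.IsSubordinate fun p ↦ (extChartAt (𝓡 n) (p : M)).source)
include hρ

theorem volIntegral_laplacian (hw : ContMDiff (𝓡 n) 𝓘(ℝ, ℝ) 2 w) :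
    m.volIntegral ρ (m.laplacian w) = 0 := by
  have continuous_term (p : t) := m.continuous_laplacian (contMDiff_partition_mul (ρ := ρ) hw p)
  rw [← funext (m.sum_laplacian_partition_mul (ρ := ρ) hw),
    m.volIntegral_sum hρ _ fun p _ ↦ continuous_term p]
  refine Finset.sum_eq_zero fun p _ ↦ ?_
  have hs := tsupport_partition_mul_subset hρ p w
  rw [m.volIntegral_eq_chartIntegral hρ (continuous_term p)
    (m.tsupport_laplacian_subset.trans hs),
    m.chartIntegral_laplacian (contMDiff_partition_mul hw p) hs]

theorem volIntegral_bochnerIntegrand_nonneg {K : ℝ} (hRic : m.RicciBoundedBelow K)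
    (hu : ContMDiff (𝓡 n) 𝓘(ℝ, ℝ) 2 u) (hw : ContMDiff (𝓡 n) 𝓘(ℝ, ℝ) 2 w)
    (hw0 : ∀ x, 0 ≤ w x) : 0 ≤ m.volIntegral ρ (m.bochnerIntegrand K w u) := by
  have continuous_term (p : t) :=
    m.continuous_bochnerIntegrand K (contMDiff_partition_mul (ρ := ρ) hw p) hu
  rw [← funext (m.sum_bochnerIntegrand_partition_mul (ρ := ρ) K hw),
    m.volIntegral_sum hρ _ fun p _ ↦ continuous_term p]
  refine Finset.sum_nonneg fun p _ ↦ ?_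
  have hs := tsupport_partition_mul_subset hρ p w
  rw [m.volIntegral_eq_chartIntegral hρ (continuous_term p)
    ((m.tsupport_bochnerIntegrand_subset K).trans hs)]
  exact m.chartIntegral_bochnerIntegrand_nonneg hRic hu (contMDiff_partition_mul hw p)
    (fun x ↦ mul_nonneg (ρ.nonneg p x) (hw0 x)) hs

lemma volIntegral_comp_real (hu : ContMDiff (𝓡 n) 𝓘(ℝ, ℝ) 2 u) {H H' H'' : ℝ → ℝ}
    (hH : ∀ t, HasDerivAt H (H' t) t) (hH' : ∀ t, HasDerivAt H' (H'' t) t)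
    (hH'' : Continuous H'') :
    m.volIntegral ρ
      (fun x ↦ H' (u x) * m.laplacian u x + H'' (u x) * m.gradInner u u x) = 0 := by
  have contDiff_H' : ContDiff ℝ 1 H' :=
    contDiff_succ_of_hasDerivAt (k := 0) hH' (contDiff_zero.2 hH'')
  have contDiff_H : ContDiff ℝ 2 H := contDiff_succ_of_hasDerivAt (k := 1) hH contDiff_H'
  rw [← m.volIntegral_laplacian hρ (contDiff_H.contMDiff.comp hu)]
  exact congrArg _ (funext fun x ↦ (m.laplacian_comp_real hH (hH' _) (hu x)).symm)

end WeightedBochner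

/-! ### Solutions of `Δu = -g(u)` -/

/-- The function whose composition with a non-negative solution `u` of `Δu = -g(u)` has
non-negative integral when `Ric ≥ (n - 1)κ`. -/
def rigidityFunction (n : ℕ) (κ : ℝ) (g : ℝ → ℝ) (t : ℝ) : ℝ :=
  g t * (2 * ((n : ℝ) - 1) * t * g t / n - 3 * (∫ σ in (0 : ℝ)..t, g σ)
    - ((n : ℝ) - 1) * κ * t ^ 2)

lemma continuous_rigidityFunction (n : ℕ) (κ : ℝ) {g : ℝ → ℝ} (hg : Continuous g) :
    Continuous (rigidityFunction n κ g) := by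
  unfold rigidityFunction
  fun_prop

section Solution

variable (m : SmoothMetric n M) {κ : ℝ} {g : ℝ → ℝ} {u : M → ℝ}

lemma rigidityFunction_eq_bochnerIntegrand (hn : n ≠ 0) (κ : ℝ) {x : M}
    (hsol : m.laplacian u x = -g (u x)) :
    rigidityFunction n κ g (u x)
      = 2 * m.bochnerIntegrand (((n : ℝ) - 1) * κ) u u x
        + (3 * ((∫ σ in (0 : ℝ)..u x, g σ) * m.laplacian u x + g (u x) * m.gradInner u u x)
          + 2 * (((n : ℝ) - 1) * κ)
            * (u x ^ 2 / 2 * m.laplacian u x + u x * m.gradInner u u x)) := by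
  have : (n : ℝ) ≠ 0 := Nat.cast_ne_zero.2 hn
  simp only [rigidityFunction, bochnerIntegrand, hsol]
  field_simp
  ring

theorem volIntegral_rigidityFunction_nonneg [CompactSpace M] (hn : n ≠ 0)
    (hRic : m.RicciBoundedBelow (((n : ℝ) - 1) * κ)) (hg : Continuous g)
    (hu : ContMDiff (𝓡 n) 𝓘(ℝ, ℝ) 2 u) (hu0 : ∀ x, 0 ≤ u x)
    (hsol : ∀ x, m.laplacian u x = -g (u x)) {t : Finset M}
    {ρ : SmoothPartitionOfUnity t (𝓡 n) M Set.univ}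
    (hρ : ρ.IsSubordinate fun p ↦ (extChartAt (𝓡 n) (p : M)).source) :
    0 ≤ m.volIntegral ρ fun x ↦ rigidityFunction n κ g (u x) := by
  let G : ℝ → ℝ := fun t ↦ ∫ σ in (0 : ℝ)..t, g σ
  have hasDerivAt_G (t : ℝ) : HasDerivAt G (g t) t := (hg.integral_hasStrictDerivAt 0 t).hasDerivAt
  have continuous_G : Continuous G := by fun_prop
  have integral_G := m.volIntegral_comp_real hρ hu
    (fun t ↦ (continuous_G.integral_hasStrictDerivAt 0 t).hasDerivAt) hasDerivAt_G hg
  have integral_cube := m.volIntegral_comp_real hρ hu (H := fun t ↦ t ^ 3 / 6)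
    (H' := fun t ↦ t ^ 2 / 2) (H'' := fun t ↦ t)
    (fun t ↦ ((hasDerivAt_pow 3 t).div_const 6).congr_deriv (by norm_num; ring))
    (fun t ↦ ((hasDerivAt_pow 2 t).div_const 2).congr_deriv (by norm_num)) continuous_id
  have bochner := m.volIntegral_bochnerIntegrand_nonneg hρ hRic hu hu hu0
  have continuous_u := hu.continuous
  have continuous_bochner := m.continuous_bochnerIntegrand (((n : ℝ) - 1) * κ) hu hu
  have continuous_laplacian_u := m.continuous_laplacian hu
  have continuous_gradInner_u :=
    m.continuous_gradInner (hu.of_le one_le_two) (hu.of_le one_le_two)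
  simp only [m.rigidityFunction_eq_bochnerIntegrand hn κ (hsol _)]
  rw [m.volIntegral_add hρ (by fun_prop) (by fun_prop),
    m.volIntegral_add hρ (by fun_prop) (by fun_prop), volIntegral_const_mul,
    volIntegral_const_mul, volIntegral_const_mul, integral_G, integral_cube]
  linarith

end Solution

end SmoothMetric

end

lemma exists_eq_const_of_forall_mem {X Y : Type*} [TopologicalSpace X] [ConnectedSpace X]
    [TopologicalSpace Y] {Z : Set Y} (hZ : IsTotallyDisconnected Z) {f : X → Y}
    (hf : Continuous f) (hmem : ∀ x, f x ∈ Z) : ∃ c, ∀ x, f x = c := by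
  obtain ⟨x₀⟩ := ‹ConnectedSpace X›.toNonempty
  exact ⟨f x₀, fun x ↦ hZ _ (Set.range_subset_iff.2 hmem) (isPreconnected_range hf)
    (Set.mem_range_self x) (Set.mem_range_self x₀)⟩

theorem corollary1p9_general {n : ℕ} {M : Type*} [TopologicalSpace M]
    [ChartedSpace (EuclideanSpace ℝ (Fin n)) M] [IsManifold (𝓡 n) ∞ M]
    [T2Space M] [CompactSpace M] [ConnectedSpace M]
    (m : SmoothMetric n M) {κ : ℝ} (hRic : m.RicciBoundedBelow (((n : ℝ) - 1) * κ))
    {g : ℝ → ℝ} (hg : Continuous g)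
    {S : Set ℝ} (hS : IsTotallyDisconnected S)
    (hle : ∀ t ∈ S, SmoothMetric.rigidityFunction n κ g t ≤ 0)
    (hneg : ∀ t ∈ Set.Ici (0 : ℝ) \ S, SmoothMetric.rigidityFunction n κ g t < 0)
    {u : M → ℝ} (hu : ContMDiff (𝓡 n) 𝓘(ℝ, ℝ) 2 u) (hu0 : ∀ x, 0 ≤ u x)
    (hsol : ∀ x, m.laplacian u x = -g (u x)) :
    ∃ c : ℝ, ∀ x, u x = c := by
  have rigidityFunction_eq_zero (x : M) : SmoothMetric.rigidityFunction n κ g (u x) = 0 := by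
    rcases eq_or_ne n 0 with rfl | hn
    · have g_eq_zero : g (u x) = 0 := by
        rw [← neg_eq_zero, ← hsol]
        simp [SmoothMetric.laplacian, LocalGeometry.laplacian]
      rw [SmoothMetric.rigidityFunction, g_eq_zero, zero_mul]
    have rigidityFunction_nonpos (z : M) : SmoothMetric.rigidityFunction n κ g (u z) ≤ 0 := by
      by_cases hz : u z ∈ S
      · exact hle _ hz
      · exact (hneg _ ⟨hu0 z, hz⟩).le
    obtain ⟨t, ρ, hρ⟩ := SmoothMetric.exists_partition_subordinate_charts n M
    exact m.eq_zero_of_volIntegral_nonneg hρ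
      ((SmoothMetric.continuous_rigidityFunction n κ hg).comp hu.continuous)
      rigidityFunction_nonpos
      (m.volIntegral_rigidityFunction_nonneg hn hRic hg hu hu0 hsol hρ) x
  exact exists_eq_const_of_forall_mem hS hu.continuous fun x ↦
    by_contra fun hx ↦ (hneg _ ⟨hu0 x, hx⟩).ne (rigidityFunction_eq_zero x)

/-- A closed manifold is here compact, connected, Hausdorff and without boundary; a solution is
a classical (`C²`) solution. -/
theorem corollary1p9 (n : ℕ) {M : Type*} [TopologicalSpace M]
    [ChartedSpace (EuclideanSpace ℝ (Fin n)) M] [IsManifold (𝓡 n) ∞ M]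
    [T2Space M] [CompactSpace M] [ConnectedSpace M]
    (m : SmoothMetric n M) (κ : ℝ) (hRic : m.RicciBoundedBelow (((n : ℝ) - 1) * κ))
    (g : ℝ → ℝ) (hg : Continuous g)
    (S : Set ℝ) (hS : S ⊆ Set.Ici 0) (hSd : DiscreteTopology S)
    (hzero : ∀ t ∈ S,
      g t * (2 * ((n : ℝ) - 1) * t * g t / n - 3 * (∫ σ in (0 : ℝ)..t, g σ)
        - ((n : ℝ) - 1) * κ * t ^ 2) = 0)
    (hneg : ∀ t ∈ Set.Ici (0 : ℝ) \ S,
      g t * (2 * ((n : ℝ) - 1) * t * g t / n - 3 * (∫ σ in (0 : ℝ)..t, g σ)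
        - ((n : ℝ) - 1) * κ * t ^ 2) < 0)
    (u : M → ℝ) (hu : ContMDiff (𝓡 n) 𝓘(ℝ, ℝ) 2 u) (hu0 : ∀ x, 0 ≤ u x)
    (hsol : ∀ x, m.laplacian u x = -g (u x)) :
    ∃ c : ℝ, ∀ x, u x = c := by
  exact corollary1p9_general m hRic hg (totallyDisconnectedSpace_subtype_iff.1 inferInstance)
    (fun t ht ↦ (hzero t ht).le) hneg hu hu0 hsol
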